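/- Let $N\ge 1$ and let $\lambda_1,\dots,\lambda_N$ be the eigenvalues of a random matrix from the Gaussian unitary ensemble (GUE), i.e. of a random $N\times N$ complex Hermitian matrix $X$ with probability density proportional to $e^{-\operatorname{Tr} X^2}$. Write $\langle\cdot\rangle$ for the ensemble average and $\operatorname{Cov}(A,B)=\langle (A-\langle A\rangle)(B-\langle B\rangle)\rangle$ (no complex conjugation). Let $$K_N^{(L)}(x,y)=\sum_{n=0}^{N-1}\frac{\psi_n(x)\psi_n(y)}{(p_n,p_n)},\qquad \psi_n(x)=e^{-x/2}p_n(x),\quad p_n(x)=(-1)^n n!\,L_n^{(0)}(x),\quad (p_n,p_n)=\int_0^\infty e^{-x}p_n(x)^2\,dx,$$ be the correlation kernel of the Laguerre unitary ensemble with parameter $a=0$, where $L_n^{(0)}(x)=\sum_{m=0}^n(-1)^m\binom nm\frac{x^m}{m!}$, and set $$H^{(L)}(t_1,t_2)=\frac{t_1+t_2}{2}\,K_N^{(L)}\!\left(\frac{t_1^2}{2},\frac{t_2^2}{2}\right).$$ Then for all $k\in\mathbb C$ the statistic $\sum_{j=1}^N e^{ik\lambda_j}$ is square integrable, and for all $k_1,k_2\in\mathbb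 C$ (in particular for all real $k_1,k_2$), $$\operatorname{Cov}\Big(\sum_{j=1}^N e^{ik_1\lambda_j},\ \sum_{j=1}^N e^{-ik_2\lambda_j}\Big)=\int_0^{k_2}H^{(L)}(k_1-k_2+s,\,s)\,ds,$$ the integral being taken along the straight segment from $0$ to $k_2$. In particular, for every $k\in\mathbb R$, the averaged structure function $\bar S_N(k)=\big\langle\big|\sum_{j=1}^N e^{ik\lambda_j}\big|^2\big\rangle-\big|\big\langle\sum_{j=1}^N e^{ik\lambda_j}\big\rangle\big|^2$ satisfies $$\bar S_N(k)=\int_0^k t\,K_N^{(L)}\!\left(\frac{t^2}{2},\frac{t^2}{2}\right)dt .$$ -/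

import Mathlib

open MeasureTheory ProbabilityTheory Polynomial
open scoped Nat NNReal

noncomputable section

namespace GUE

/-- The Hermitian matrix with free real coordinates `x (i, j)`: diagonal entries `x (i, i)`, and
entries `(x (i, j) + i x (j, i)) / √2` above the diagonal. One has `Tr X² = ∑ x (i, j) ^ 2`. -/
def matrix {N : ℕ} (x : Fin N × Fin N → ℝ) : Matrix (Fin N) (Fin N) ℂ :=
  Matrix.of fun i j =>
    if i = j then (x (i, i) : ℂ)
    else if i < j then ((x (i, j) : ℂ) + Complex.I * (x (j, i) : ℂ)) / (Real.sqrt 2 : ℂ)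
    else ((x (j, i) : ℂ) - Complex.I * (x (i, j) : ℂ)) / (Real.sqrt 2 : ℂ)

theorem matrix_isHermitian {N : ℕ} (x : Fin N × Fin N → ℝ) : (matrix x).IsHermitian := by
  ext i j
  rcases lt_trichotomy i j with h | h | h
  · simp [matrix, h, h.ne, h.ne', h.not_gt, sub_eq_add_neg]
  · subst h
    simp [matrix]
  · simp [matrix, h, h.ne, h.ne', h.not_gt, sub_eq_add_neg]

/-- The law of the coordinates: i.i.d. centred Gaussians of variance `1/2`, so that the matrix
has density proportional to `exp (-Tr X²)` on the space of Hermitian matrices. -/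
def measure (N : ℕ) : Measure (Fin N × Fin N → ℝ) :=
  Measure.pi fun _ => gaussianReal 0 (1 / 2 : ℝ≥0)

/-- The eigenvalues `λ_j` of the random matrix. -/
def eigenvalue {N : ℕ} (x : Fin N × Fin N → ℝ) (j : Fin N) : ℝ :=
  (matrix_isHermitian x).eigenvalues j

/-- The linear statistic `∑_j exp (i k λ_j)`, for a real or complex parameter `k`. -/
def expStat (N : ℕ) (k : ℂ) (x : Fin N × Fin N → ℝ) : ℂ :=
  ∑ j : Fin N, Complex.exp (Complex.I * k * (eigenvalue x j : ℂ))

/-- The ensemble average. -/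
def avg (N : ℕ) (A : (Fin N × Fin N → ℝ) → ℂ) : ℂ :=
  ∫ x, A x ∂(measure N)

/-- The (bilinear) covariance `⟨(A - ⟨A⟩) (B - ⟨B⟩)⟩`. -/
def cov (N : ℕ) (A B : (Fin N × Fin N → ℝ) → ℂ) : ℂ :=
  avg N fun x => (A x - avg N A) * (B x - avg N B)

/-- The averaged structure function `⟨|∑ exp (i k λ_j)|²⟩ - |⟨∑ exp (i k λ_j)⟩|²`. -/
def structureFunction (N : ℕ) (k : ℝ) : ℝ :=
  (∫ x, ‖expStat N k x‖ ^ 2 ∂(measure N)) - ‖avg N (expStat N k)‖ ^ 2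

end GUE

namespace LUE

/-- The Laguerre polynomial `L_n^{(0)}`. -/
def laguerre (n : ℕ) : ℝ[X] :=
  ∑ m ∈ Finset.range (n + 1), C ((-1 : ℝ) ^ m * (n.choose m : ℝ) / (m ! : ℝ)) * X ^ m

/-- The monic orthogonal polynomials `p_n = (-1)^n n! L_n^{(0)}` of the weight `exp (-x)`, `x > 0`
(the Laguerre weight `x ^ a exp (-x)` with `a = 0`). -/
def monicPoly (n : ℕ) : ℝ[X] :=
  C ((-1 : ℝ) ^ n * (n ! : ℝ)) * laguerre n

/-- The inner product `(p_n, p_n)` with respect to the weight `exp (-x)` on `x > 0`. -/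
def normSq (n : ℕ) : ℝ :=
  ∫ x in Set.Ioi (0 : ℝ), Real.exp (-x) * ((monicPoly n).eval x) ^ 2

/-- `ψ_n(x) = exp (-x/2) p_n(x)`, as an entire function. -/
def psi (n : ℕ) (x : ℂ) : ℂ :=
  Complex.exp (-x / 2) * aeval x (monicPoly n)

/-- The correlation kernel `K_N^{(L)}` at `a = 0`. -/
def kernel (N : ℕ) (x y : ℂ) : ℂ :=
  ∑ n ∈ Finset.range N, psi n x * psi n y / (normSq n : ℂ)

/-- `H^{(L)}(t₁, t₂) = ((t₁ + t₂) / 2) K_N^{(L)}(t₁² / 2, t₂² / 2)` at `a = 0`. -/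
def H (N : ℕ) (t₁ t₂ : ℂ) : ℂ :=
  (t₁ + t₂) / 2 * kernel N (t₁ ^ 2 / 2) (t₂ ^ 2 / 2)

end LUE

end

/-! Let `h_n` be the monic Hermite polynomials of the law `γ = N(0, 1/2)`, `c_n` their squared
norms, and `G_ij(a) = ∫ h_i h_j exp(a x) dγ`. The determinantal structure of the eigenvalues gives
the covariance as `∑ G_ii(i(k₁ - k₂)) / c_i - ∑∑ G_ij(i k₁) G_ij(-i k₂) / (c_i c_j)`, which is
`covSum`.

That structure is reached without a change of variables to eigenvalues. The mixed moments of power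
traces under the matrix law, and those of power sums under `γ^N` weighted by the squared
Vandermonde, obey the same loop equations, and these determine them (`LoopEquations.unique`).
Andréief's identity evaluates the second family; power series and dominated convergence pass to
exponentials (`integral_expStat_mul_expStat`).

Now fix `d = k₁ - k₂` and vary `t = k₂`. The single sum is constant, and at `t = 0` everything
cancels by orthogonality. The derivative in `t` is `H` (`hasDerivAt_covSum`): raising `N` by one
adds a row and a column whose derivatives telescope as in Christoffel–Darboux, and integration by
parts turns what remains into `(d + 2t)/2 · G_NN G_NN / c_N²`. Since `G_nn(ik) / c_n = exp(-k²/4)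
L_n(k²/2)` (`gaussExp_hermitePoly_sq`), this is the new term of the Laguerre kernel. Integrating
from `0` to `k₂` gives the theorem. -/

noncomputable section

namespace GUE

/-! ### One-dimensional Gaussian integrals with an exponential tilt. -/

/-- The law `N(0, 1/2)` of a single matrix coordinate. -/
abbrev coordLaw : Measure ℝ := gaussianReal 0 (1 / 2 : ℝ≥0)

theorem integrable_pow_abs_mul_exp_abs (n : ℕ) (c : ℝ) :
    Integrable (fun x : ℝ => |x| ^ n * Real.exp (c * |x|)) coordLaw := by
  -- Any exponential rate above `|c|` absorbs the power; `|c| + 1` is one.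
  have h := integrable_pow_abs_mul_exp_add_of_integrable_exp_mul (X := fun x : ℝ => x)
    (μ := coordLaw) (v := 0) (t := |c| + 1) (x := |c|) (integrable_exp_mul_gaussianReal _)
    (integrable_exp_mul_gaussianReal _) (abs_nonneg c)
    (lt_of_lt_of_le (lt_add_one _) (le_abs_self _)) n
  refine h.mono' (by fun_prop) (Filter.Eventually.of_forall fun x => ?_)
  simp only [Real.norm_eq_abs, abs_mul, abs_pow, abs_abs, Real.abs_exp, zero_mul, zero_add]
  gcongr
  exact le_abs_self c

theorem integrable_norm_eval_mul_exp_abs (p : ℂ[X]) (c : ℝ) :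
    Integrable (fun x : ℝ => ‖p.eval (x : ℂ)‖ * Real.exp (c * |x|)) coordLaw := by
  induction p using Polynomial.induction_on' with
  | add p q hp hq =>
    refine (hp.add hq).mono' (by fun_prop) (Filter.Eventually.of_forall fun x => ?_)
    simp only [norm_mul, Real.norm_eq_abs, Real.abs_exp, eval_add, Pi.add_apply, abs_norm]
    rw [← add_mul]
    gcongr
    exact norm_add_le _ _
  | monomial n a =>
    refine ((integrable_pow_abs_mul_exp_abs n c).const_mul ‖a‖).congr
      (Filter.Eventually.of_forall fun x => ?_)
    simp [mul_assoc]

theorem norm_exp_mul_ofReal_le (a : ℂ) (x : ℝ) :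
    ‖Complex.exp (a * x)‖ ≤ Real.exp (‖a‖ * |x|) := by
  rw [Complex.norm_exp, Real.exp_le_exp]
  refine (Complex.re_le_norm _).trans ?_
  simp

theorem integrable_eval_mul_exp (a : ℂ) (p : ℂ[X]) :
    Integrable (fun x : ℝ => p.eval (x : ℂ) * Complex.exp (a * x)) coordLaw := by
  refine (integrable_norm_eval_mul_exp_abs p ‖a‖).mono' (by fun_prop)
    (Filter.Eventually.of_forall fun x => ?_)
  rw [norm_mul]
  gcongr
  exact norm_exp_mul_ofReal_le a x

/-- The functional `p ↦ ∫ p(x) exp (a x) dγ(x)` on polynomials, `γ = N(0, 1/2)`. -/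
def gaussExp (a : ℂ) : ℂ[X] →ₗ[ℂ] ℂ where
  toFun p := ∫ x : ℝ, p.eval (x : ℂ) * Complex.exp (a * x) ∂coordLaw
  map_add' p q := by
    simp only [eval_add, add_mul]
    exact integral_add (integrable_eval_mul_exp a p) (integrable_eval_mul_exp a q)
  map_smul' c p := by
    simp only [eval_smul, smul_eq_mul, mul_assoc, RingHom.id_apply]
    exact integral_const_mul _ _

theorem gaussExp_apply (a : ℂ) (p : ℂ[X]) :
    gaussExp a p = ∫ x : ℝ, p.eval (x : ℂ) * Complex.exp (a * x) ∂coordLaw := rfl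

theorem gaussExp_zero_apply (p : ℂ[X]) :
    gaussExp 0 p = ∫ x : ℝ, p.eval (x : ℂ) ∂coordLaw := by
  simp [gaussExp_apply]

theorem gaussExp_one (a : ℂ) : gaussExp a 1 = Complex.exp (a ^ 2 / 4) := by
  have h := complexMGF_id_gaussianReal (μ := 0) (v := 1 / 2) a
  simp only [complexMGF, id] at h
  rw [gaussExp_apply]
  simp only [eval_one, one_mul]
  rw [h]
  congr 1
  push_cast
  ring

theorem hasDerivAt_gaussExp (p : ℂ[X]) (a : ℂ) :
    HasDerivAt (fun a => gaussExp a p) (gaussExp a (X * p)) a := by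
  induction p using Polynomial.induction_on' with
  | add p q hp hq =>
    simp only [map_add, mul_add]
    exact hp.add hq
  | monomial n c =>
    have h := hasDerivAt_integral_pow_mul_exp (X := fun x : ℝ => x) (μ := coordLaw) (z := a)
      (by simp) n
    have h1 : ∀ (m : ℕ) (b : ℂ), gaussExp b (monomial m c) =
        c * ∫ x : ℝ, (x : ℂ) ^ m * Complex.exp (b * x) ∂coordLaw := by
      intro m b
      rw [gaussExp_apply, ← integral_const_mul]
      simp [mul_assoc]
    rw [X_mul_monomial]
    simp only [h1]
    exact h.const_mul c

/-- Gaussian integration by parts, obtained by differentiating in the tilt: `d/da` inserts a factor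
`X`, so each power follows from the previous one, starting from the derivative of `exp(a²/4)`. -/
theorem gaussExp_X_mul (a : ℂ) (p : ℂ[X]) :
    gaussExp a (X * p) = gaussExp a (derivative p) / 2 + a / 2 * gaussExp a p := by
  have key : ∀ n : ℕ, ∀ a : ℂ, gaussExp a (X * X ^ n) =
      gaussExp a (derivative (X ^ n)) / 2 + a / 2 * gaussExp a (X ^ n) := by
    intro n
    induction n with
    | zero =>
      intro a
      have h1 := hasDerivAt_gaussExp 1 a
      simp only [gaussExp_one] at h1
      have h2 : HasDerivAt (fun a : ℂ => Complex.exp (a ^ 2 / 4))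
          (Complex.exp (a ^ 2 / 4) * (2 * a / 4)) a := by
        have := ((hasDerivAt_id a).pow 2).div_const 4 |>.cexp
        simpa using this
      rw [pow_zero, h1.unique h2, gaussExp_one]
      simp
      ring
    | succ n ih =>
      intro a
      have h1 := hasDerivAt_gaussExp (X * X ^ n) a
      have h2 := ((hasDerivAt_gaussExp (derivative (X ^ n)) a).div_const 2).add
        (((hasDerivAt_id a).div_const 2).mul (hasDerivAt_gaussExp (X ^ n) a))
      have h3 := h1.unique (h2.congr_of_eventuallyEq (Filter.Eventually.of_forall fun b => ih b))
      rw [pow_succ' X n, h3]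
      simp only [derivative_mul, derivative_X, one_mul, map_add, id]
      ring
  induction p using Polynomial.induction_on' with
  | add p q hp hq => simp only [mul_add, map_add, hp, hq]; ring
  | monomial n c =>
    rw [← C_mul_X_pow_eq_monomial, ← smul_eq_C_mul, mul_smul_comm, derivative_smul]
    simp only [map_smul, key, smul_eq_mul]
    ring

/-- Completing the square. For complex `a` the shift by `a/2` is not a real change of variables, so
both sides are matched through the recursion `gaussExp_X_mul`. -/
theorem gaussExp_eq_comp (a : ℂ) (p : ℂ[X]) :
    gaussExp a p = Complex.exp (a ^ 2 / 4) * gaussExp 0 (p.comp (X + C (a / 2))) := by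
  induction p using Polynomial.induction_on' with
  | add p q hp hq => simp only [add_comp, map_add, hp, hq]; ring
  | monomial n c =>
    rw [← C_mul_X_pow_eq_monomial, ← smul_eq_C_mul, smul_comp, map_smul, map_smul]
    suffices gaussExp a (X ^ n) = Complex.exp (a ^ 2 / 4) *
        gaussExp 0 ((X ^ n : ℂ[X]).comp (X + C (a / 2))) by
      rw [this, smul_eq_mul, smul_eq_mul]; ring
    induction n using Nat.strong_induction_on with
    | _ n ih =>
      match n with
      | 0 => simp [gaussExp_one]
      | n + 1 =>
        rw [pow_succ', gaussExp_X_mul, mul_comp, X_comp, add_mul, map_add, gaussExp_X_mul,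
          ih n (by omega), derivative_comp, ← smul_eq_C_mul, map_smul]
        have : gaussExp a (derivative (X ^ n)) = Complex.exp (a ^ 2 / 4) *
            gaussExp 0 ((derivative (X ^ n : ℂ[X])).comp (X + C (a / 2))) := by
          rcases n with _ | n
          · simp
          · rw [derivative_X_pow, ← smul_eq_C_mul, map_smul, smul_comp, map_smul]
            simp only [Nat.add_sub_cancel]
            rw [ih n (by omega), smul_eq_mul, smul_eq_mul]; ring
        rw [this]
        simp
        ring

/-! ### Hermite polynomials and their Laguerre diagonal integrals. -/

/-- The monic Hermite polynomials of the weight `exp (-x²)`. -/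
def hermitePoly : ℕ → ℂ[X]
  | 0 => 1
  | n + 1 => X * hermitePoly n - C (1 / 2) * derivative (hermitePoly n)

theorem derivative_hermitePoly_succ (n : ℕ) :
    derivative (hermitePoly (n + 1)) = C ((n : ℂ) + 1) * hermitePoly n := by
  induction n with
  | zero => simp [hermitePoly]
  | succ n ih =>
    rw [hermitePoly, derivative_sub, derivative_mul, derivative_X, derivative_C_mul, ih,
      derivative_C_mul]
    rw [hermitePoly]
    simp only [map_add, map_natCast, map_one, Nat.cast_add, Nat.cast_one]
    ring

theorem derivative_hermitePoly (n : ℕ) :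
    derivative (hermitePoly n) = C (n : ℂ) * hermitePoly (n - 1) := by
  cases n with
  | zero => simp [hermitePoly]
  | succ n => simpa using derivative_hermitePoly_succ n

theorem X_mul_hermitePoly (n : ℕ) :
    X * hermitePoly n = hermitePoly (n + 1) + C ((n : ℂ) / 2) * hermitePoly (n - 1) := by
  rw [hermitePoly, derivative_hermitePoly, ← mul_assoc, ← C_mul, sub_add, one_div_mul_eq_div]
  ring

theorem hermitePoly_monic_natDegree (n : ℕ) :
    (hermitePoly n).Monic ∧ (hermitePoly n).natDegree = n := by
  induction n with
  | zero => simp [hermitePoly]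
  | succ n ih =>
    obtain ⟨hm, hd⟩ := ih
    have hX : (X * hermitePoly n).Monic := monic_X.mul hm
    have hdX : (X * hermitePoly n).natDegree = n + 1 := by
      rw [natDegree_X_mul hm.ne_zero, hd]
    have hltn : (C (1 / 2 : ℂ) * derivative (hermitePoly n)).natDegree <
        (X * hermitePoly n).natDegree := by
      rw [hdX]
      refine lt_of_le_of_lt ((natDegree_C_mul_le _ _).trans (natDegree_derivative_le _)) ?_
      omega
    rw [hermitePoly]
    refine ⟨hX.sub_of_left (degree_lt_degree hltn), ?_⟩
    rw [natDegree_sub_eq_left_of_natDegree_lt hltn, hdX]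

/-- The raising operator `X - D/2` has adjoint `D/2 + a/2` for the tilted functional. -/
theorem gaussExp_hermitePoly_succ_mul (a : ℂ) (n : ℕ) (q : ℂ[X]) :
    gaussExp a (hermitePoly (n + 1) * q) =
      gaussExp a (hermitePoly n * derivative q) / 2 + a / 2 * gaussExp a (hermitePoly n * q) := by
  rw [hermitePoly, sub_mul, map_sub, mul_assoc, gaussExp_X_mul, derivative_mul, map_add,
    mul_assoc, ← smul_eq_C_mul, map_smul, smul_eq_mul]
  ring

/-- The squared norm `n! / 2 ^ n` of the monic Hermite polynomial of degree `n`. -/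
def hermiteNormSq (n : ℕ) : ℂ := (n ! : ℂ) / 2 ^ n

theorem hermiteNormSq_ne_zero (n : ℕ) : hermiteNormSq n ≠ 0 := by
  have : (n ! : ℂ) ≠ 0 := by exact_mod_cast n.factorial_ne_zero
  exact div_ne_zero this (pow_ne_zero _ two_ne_zero)

theorem hermiteNormSq_succ (n : ℕ) :
    hermiteNormSq (n + 1) = ((n : ℂ) + 1) / 2 * hermiteNormSq n := by
  unfold hermiteNormSq
  rw [Nat.factorial_succ, pow_succ]
  push_cast
  field_simp

theorem gaussExp_zero_hermitePoly_mul (i j : ℕ) :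
    gaussExp 0 (hermitePoly i * hermitePoly j) = if i = j then hermiteNormSq i else 0 := by
  induction i generalizing j with
  | zero =>
    cases j with
    | zero => simp [hermitePoly, hermiteNormSq, gaussExp_one]
    | succ j =>
      rw [mul_comm, gaussExp_hermitePoly_succ_mul]
      simp [hermitePoly]
  | succ i ih =>
    rw [gaussExp_hermitePoly_succ_mul]
    cases j with
    | zero => simp [hermitePoly]
    | succ j =>
      rw [derivative_hermitePoly_succ, mul_left_comm, ← smul_eq_C_mul, map_smul, ih]
      by_cases h : i = j
      · subst h
        simp [hermiteNormSq_succ]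
        ring
      · simp [h]

/-- With `R = X - D/2` one has `h_n = R^n 1`. Translation by `y` turns `R` into `R + y`, and `y` is
a scalar, so the binomial theorem applies. -/
theorem hermitePoly_comp_X_add_C (n : ℕ) (y : ℂ) :
    (hermitePoly n).comp (X + C y) =
      ∑ m ∈ Finset.range (n + 1), (y ^ (n - m) * (n.choose m : ℂ)) • hermitePoly m := by
  let R : Module.End ℂ ℂ[X] := LinearMap.mulLeft ℂ X - (1 / 2 : ℂ) • derivative
  have hR : ∀ p, R p = X * p - C (1 / 2) * derivative p := fun p => by
    simp [R, smul_eq_C_mul]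
  have h1 : ∀ n, (R ^ n) 1 = hermitePoly n := by
    intro n
    induction n with
    | zero => rfl
    | succ n ih => rw [pow_succ', Module.End.mul_apply, ih, hR, hermitePoly]
  have h2 : ∀ n, ((R + algebraMap ℂ _ y) ^ n) 1 = (hermitePoly n).comp (X + C y) := by
    intro n
    induction n with
    | zero => simp [hermitePoly]
    | succ n ih =>
      rw [pow_succ', Module.End.mul_apply, ih, LinearMap.add_apply, hR, hermitePoly,
        Module.algebraMap_end_apply, derivative_comp, sub_comp, mul_comp, mul_comp, X_comp,
        C_comp, smul_eq_C_mul]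
      simp only [derivative_add, derivative_X, derivative_C, add_zero, one_mul]
      ring
  rw [← h2, (Algebra.commute_algebraMap_right y R).add_pow, LinearMap.sum_apply]
  refine Finset.sum_congr rfl fun m _ => ?_
  rw [← map_pow, ← map_natCast (algebraMap ℂ (Module.End ℂ ℂ[X])), mul_assoc, ← map_mul,
    ← Algebra.commutes, Module.End.mul_apply, h1, Module.algebraMap_end_apply]

/-- The bridge from Hermite to Laguerre: shift by `a/2`, expand both factors in the Hermite basis,
and let orthogonality keep the diagonal. -/
theorem gaussExp_hermitePoly_sq (a : ℂ) (n : ℕ) :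
    gaussExp a (hermitePoly n * hermitePoly n) =
      hermiteNormSq n * (Complex.exp (a ^ 2 / 4) * aeval (-a ^ 2 / 2) (LUE.laguerre n)) := by
  rw [gaussExp_eq_comp, mul_comp, hermitePoly_comp_X_add_C, Finset.sum_mul_sum]
  simp only [map_sum, smul_mul_smul_comm, map_smul, gaussExp_zero_hermitePoly_mul, smul_eq_mul,
    mul_ite, mul_zero, Finset.sum_ite_eq, Finset.mem_range]
  rw [mul_left_comm]
  congr 1
  -- The summation is reversed because the shift appears to the power `n - m`, which is the Laguerre
  -- index.
  rw [LUE.laguerre, map_sum, Finset.mul_sum, ← Finset.sum_range_reflect]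
  refine Finset.sum_congr rfl fun m hm => ?_
  have hm : m ≤ n := by simpa [Nat.lt_succ_iff] using hm
  have e1 : n + 1 - 1 - m = n - m := by omega
  have e2 : n - (n - m) = m := by omega
  rw [e1, e2, Nat.choose_symm hm, if_pos (by omega)]
  have e3 : ((n ! : ℕ) : ℂ) = n.choose m * m ! * (n - m)! := by
    exact_mod_cast (Nat.choose_mul_factorial_mul_factorial hm).symm
  have e4 : (2 : ℂ) ^ n = 2 ^ (n - m) * 2 ^ m := by rw [← pow_add]; congr 1; omega
  have e5 : (m ! : ℂ) ≠ 0 := by exact_mod_cast m.factorial_ne_zero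
  simp only [map_mul, aeval_C, map_pow, aeval_X, hermiteNormSq]
  rw [e3, e4]
  simp only [Complex.coe_algebraMap]
  push_cast
  have e6 : ((-1 : ℂ) ^ m) * (-(a ^ 2 / 2)) ^ m = (a / 2) ^ m * (a / 2) ^ m * 2 ^ m := by
    rw [← mul_pow, ← mul_pow, ← mul_pow]; congr 1; ring
  field_simp
  linear_combination (-(n.choose m : ℂ) ^ 2 * ((n - m)! : ℂ)) * e6

/-! ### Gaussian expectations of polynomials in several variables. -/

section GaussianFunctional

variable {σ : Type*} [Fintype σ]

theorem integrable_prod_eval (q : σ → ℂ[X]) :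
    Integrable (fun x : σ → ℝ => ∏ i, (q i).eval (x i : ℂ)) (Measure.pi fun _ => coordLaw) :=
  Integrable.fintype_prod (f := fun i (t : ℝ) => (q i).eval (t : ℂ)) fun i => by
    simpa using integrable_eval_mul_exp 0 (q i)

theorem aeval_monomial_eq_prod_eval (d : σ →₀ ℕ) (c : ℂ) (x : σ → ℝ) :
    MvPolynomial.aeval (fun i => (x i : ℂ)) (MvPolynomial.monomial d c) =
      c * ∏ i, ((X : ℂ[X]) ^ d i).eval (x i : ℂ) := by
  simp [MvPolynomial.aeval_monomial, Finsupp.prod_fintype]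

theorem integrable_aeval (p : MvPolynomial σ ℂ) :
    Integrable (fun x : σ → ℝ => MvPolynomial.aeval (fun i => (x i : ℂ)) p)
      (Measure.pi fun _ => coordLaw) := by
  induction p using MvPolynomial.induction_on' with
  | monomial d c =>
    simp only [aeval_monomial_eq_prod_eval]
    exact (integrable_prod_eval _).const_mul c
  | add p q hp hq =>
    simp only [map_add]
    exact hp.add hq

/-- The expectation of a polynomial in independent `N(0, 1/2)` variables. -/
def gaussE : MvPolynomial σ ℂ →ₗ[ℂ] ℂ where
  toFun p := ∫ x : σ → ℝ, MvPolynomial.aeval (fun i => (x i : ℂ)) p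
    ∂(Measure.pi fun _ => coordLaw)
  map_add' p q := by
    simp only [map_add]
    exact integral_add (integrable_aeval p) (integrable_aeval q)
  map_smul' c p := by
    simp only [map_smul, smul_eq_mul, RingHom.id_apply]
    exact integral_const_mul _ _

theorem gaussE_apply (p : MvPolynomial σ ℂ) :
    gaussE p = ∫ x : σ → ℝ, MvPolynomial.aeval (fun i => (x i : ℂ)) p
      ∂(Measure.pi fun _ => coordLaw) := rfl

theorem gaussE_one : gaussE (1 : MvPolynomial σ ℂ) = 1 := by
  simp [gaussE_apply]

theorem gaussE_prod (q : σ → ℂ[X]) :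
    gaussE (∏ i, aeval (MvPolynomial.X i : MvPolynomial σ ℂ) (q i)) = ∏ i, gaussExp 0 (q i) := by
  rw [gaussE_apply]
  simp only [map_prod, ← Polynomial.aeval_algHom_apply, MvPolynomial.aeval_X,
    Polynomial.coe_aeval_eq_eval, gaussExp_zero_apply]
  exact integral_fintype_prod_eq_prod (fun i (t : ℝ) => (q i).eval (t : ℂ))

theorem gaussE_monomial (d : σ →₀ ℕ) :
    gaussE (MvPolynomial.monomial d (1 : ℂ)) = ∏ i, gaussExp 0 (X ^ d i) := by
  rw [← gaussE_prod, MvPolynomial.monomial_eq, map_one, one_mul, Finsupp.prod_fintype]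
  · simp
  · simp

/-- Integration by parts in one coordinate; on monomials the integral factors and the untilted
one-variable formula applies. -/
theorem gaussE_X_mul (i : σ) (p : MvPolynomial σ ℂ) :
    gaussE (MvPolynomial.X i * p) = gaussE (MvPolynomial.pderiv i p) / 2 := by
  classical
  induction p using MvPolynomial.induction_on' with
  | add p q hp hq => simp only [mul_add, map_add, hp, hq]; ring
  | monomial d c =>
    have hs : ∀ (e : σ →₀ ℕ) (b : ℂ), MvPolynomial.monomial e b =
        b • MvPolynomial.monomial e (1 : ℂ) := by
      intro e b; simp [MvPolynomial.smul_monomial]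
    rw [MvPolynomial.pderiv_monomial, MvPolynomial.X, MvPolynomial.monomial_mul,
      one_mul, hs, hs _ (c * _), map_smul, map_smul,
      gaussE_monomial, gaussE_monomial, ← Finset.mul_prod_erase _ _ (Finset.mem_univ i),
      ← Finset.mul_prod_erase _ (fun j => gaussExp 0 (X ^ ((d - Finsupp.single i 1 : σ →₀ ℕ) j)))
        (Finset.mem_univ i)]
    have h1 : gaussExp 0 (X ^ ((Finsupp.single i 1 + d : σ →₀ ℕ) i)) =
        (d i : ℂ) * gaussExp 0 (X ^ ((d - Finsupp.single i 1 : σ →₀ ℕ) i)) / 2 := by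
      simp only [Finsupp.add_apply, Finsupp.single_eq_same, Finsupp.tsub_apply]
      rw [add_comm, pow_succ', gaussExp_X_mul, derivative_X_pow, ← smul_eq_C_mul, map_smul]
      simp
    rw [h1]
    have h2 : ∀ j ∈ Finset.univ.erase i, gaussExp 0 (X ^ ((Finsupp.single i 1 + d : σ →₀ ℕ) j)) =
        gaussExp 0 (X ^ ((d - Finsupp.single i 1 : σ →₀ ℕ) j)) := by
      intro j hj
      have hj : i ≠ j := (Finset.ne_of_mem_erase hj).symm
      simp [hj]
    rw [Finset.prod_congr rfl h2]
    simp only [smul_eq_mul]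
    ring

end GaussianFunctional

/-! ### Loop equations and their uniqueness. -/

section LoopEquations

/-- A functional on multisets of naturals satisfies the loop equations of the `N × N` GUE: this
holds for `s ↦ ⟨∏_{q ∈ s} Tr X ^ q⟩`. -/
structure LoopEquations (N : ℕ) (M : Multiset ℕ → ℂ) : Prop where
  zero : M 0 = 1
  cons_zero : ∀ s, M (0 ::ₘ s) = N * M s
  cons_succ : ∀ p s, M ((p + 1) ::ₘ s) =
    ((∑ a ∈ Finset.range p, M (a ::ₘ (p - 1 - a) ::ₘ s)) +
      (s.map fun q : ℕ => (q : ℂ) * M ((p + q - 1) ::ₘ s.erase q)).sum) / 2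

/-- Every equation lowers `sum + card`: deleting a zero and splitting `p + 1` into `a` and `p - 1 -
a` lower it by one, merging `p + 1` with a positive `q` lowers it by three. Merging with `q = 0` has
coefficient zero. -/
theorem LoopEquations.unique {N : ℕ} {M M' : Multiset ℕ → ℂ} (h : LoopEquations N M)
    (h' : LoopEquations N M') : M = M' := by
  funext s
  induction hn : s.sum + s.card using Nat.strong_induction_on generalizing s with
  | _ n ih =>
    subst hn
    induction s using Multiset.induction with
    | empty => rw [h.zero, h'.zero]
    | cons p s _ =>
      cases p with
      | zero => rw [h.cons_zero, h'.cons_zero, ih _ (by simp) s rfl]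
      | succ p =>
        rw [h.cons_succ, h'.cons_succ]
        congr 2
        · refine Finset.sum_congr rfl fun a ha => ih _ ?_ _ rfl
          have := Finset.mem_range.1 ha
          simp
          omega
        · congr 1
          refine Multiset.map_congr rfl fun q hq => ?_
          rcases Nat.eq_zero_or_pos q with rfl | hq0
          · simp
          · congr 1
            refine ih _ ?_ _ rfl
            have h1 := Multiset.sum_erase hq
            have h2 := Multiset.card_erase_of_mem hq
            have h3 : 0 < s.card := Multiset.card_pos_iff_exists_mem.2 ⟨q, hq⟩
            simp only [Multiset.sum_cons, Multiset.card_cons, Nat.pred_eq_sub_one] at h2 ⊢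
            omega

theorem derivation_sum_apply {ι A : Type*} [CommRing A] [Algebra ℂ A] (s : Finset ι)
    (D : ι → Derivation ℂ A A) (x : A) : (∑ i ∈ s, D i) x = ∑ i ∈ s, D i x := by
  have := congrFun (map_sum (Derivation.coeFnAddMonoidHom (R := ℂ) (A := A) (M := A)) D s) x
  rw [Finset.sum_apply] at this
  exact this

theorem derivation_multiset_prod {A : Type*} [CommRing A] [Algebra ℂ A] (D : Derivation ℂ A A)
    (T : ℕ → A) (s : Multiset ℕ) :
    D (s.map T).prod = (s.map fun q => D (T q) * ((s.erase q).map T).prod).sum := by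
  induction s using Multiset.induction with
  | empty => simp
  | cons a s ih =>
    rw [Multiset.map_cons, Multiset.prod_cons, D.leibniz, ih, Multiset.map_cons,
      Multiset.sum_cons, Multiset.erase_cons_head, smul_eq_mul, smul_eq_mul, mul_comm (D (T a)),
      ← Multiset.sum_map_mul_left, add_comm]
    congr 2
    refine Multiset.map_congr rfl fun q hq => ?_
    rw [Multiset.erase_cons_tail_of_mem hq, Multiset.map_cons, Multiset.prod_cons]
    ring

end LoopEquations

/-! ### Loop equations for the matrix model. -/

section MatrixSide

variable {N : ℕ}

/-- The Hermitian matrix whose entries are the coordinate polynomials. -/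
def genericMatrix (N : ℕ) : Matrix (Fin N) (Fin N) (MvPolynomial (Fin N × Fin N) ℂ) :=
  Matrix.of fun i j =>
    if i = j then MvPolynomial.X (i, i)
    else if i < j then
      (1 / (Real.sqrt 2 : ℂ)) • (MvPolynomial.X (i, j) + Complex.I • MvPolynomial.X (j, i))
    else (1 / (Real.sqrt 2 : ℂ)) • (MvPolynomial.X (j, i) - Complex.I • MvPolynomial.X (i, j))

/-- The derivation dual to the entry `(i, j)` of the generic Hermitian matrix under Gaussian
integration by parts. -/
def entryDeriv (i j : Fin N) :
    Derivation ℂ (MvPolynomial (Fin N × Fin N) ℂ) (MvPolynomial (Fin N × Fin N) ℂ) :=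
  if i = j then MvPolynomial.pderiv (i, i)
  else if i < j then
    (1 / (Real.sqrt 2 : ℂ)) •
      (MvPolynomial.pderiv (i, j) + Complex.I • MvPolynomial.pderiv (j, i))
  else (1 / (Real.sqrt 2 : ℂ)) •
      (MvPolynomial.pderiv (j, i) - Complex.I • MvPolynomial.pderiv (i, j))

theorem aeval_genericMatrix (x : Fin N × Fin N → ℝ) :
    (genericMatrix N).map (MvPolynomial.aeval fun e => (x e : ℂ)) = matrix x := by
  ext i j
  simp only [genericMatrix, matrix, Matrix.map_apply, Matrix.of_apply]
  split_ifs <;> simp [div_eq_inv_mul, mul_add]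

theorem gaussE_genericMatrix_mul (i j : Fin N) (p : MvPolynomial (Fin N × Fin N) ℂ) :
    gaussE (genericMatrix N i j * p) = gaussE (entryDeriv i j p) / 2 := by
  simp only [genericMatrix, entryDeriv, Matrix.of_apply]
  split_ifs
  · exact gaussE_X_mul _ _
  · simp only [smul_mul_assoc, add_mul, map_smul, map_add, gaussE_X_mul, Derivation.smul_apply,
      Derivation.add_apply, smul_eq_mul]
    ring
  · simp only [smul_mul_assoc, sub_mul, map_smul, map_sub, gaussE_X_mul, Derivation.smul_apply,
      Derivation.sub_apply, smul_eq_mul]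
    ring

/-- Thus `entryDeriv i j` is differentiation with respect to the entry `(j, i)`. Off the diagonal,
`(∂_x ± i∂_y)/√2` applied to `(x ± iy)/√2` gives `(1 + i²)/2 = 0` for equal signs and `1` for
opposite signs. -/
theorem entryDeriv_genericMatrix (i j k l : Fin N) :
    entryDeriv i j (genericMatrix N k l) = if k = j ∧ l = i then 1 else 0 := by
  have hs : (Real.sqrt 2 : ℂ) * (Real.sqrt 2 : ℂ) = 2 := by
    rw [← Complex.ofReal_mul, Real.mul_self_sqrt (by norm_num)]; simp
  have hs' : ((Real.sqrt 2 : ℂ))⁻¹ * (Real.sqrt 2 : ℂ)⁻¹ = 1 / 2 := by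
    rw [← mul_inv, hs]; norm_num
  have hI₁ : (Real.sqrt 2 : ℂ)⁻¹ * ((Real.sqrt 2 : ℂ)⁻¹ * Complex.I) = Complex.I / 2 := by
    linear_combination Complex.I * hs'
  have hI₂ : (Real.sqrt 2 : ℂ)⁻¹ * Complex.I * (Real.sqrt 2 : ℂ)⁻¹ = Complex.I / 2 := by
    linear_combination Complex.I * hs'
  have hI₃ : (Real.sqrt 2 : ℂ)⁻¹ * Complex.I * ((Real.sqrt 2 : ℂ)⁻¹ * Complex.I) = -(1 / 2) := by
    linear_combination (Complex.I * Complex.I) * hs' + Complex.I_mul_I / 2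
  rcases lt_trichotomy i j with hij | rfl | hij <;> rcases lt_trichotomy k l with hkl | rfl | hkl
  all_goals
    simp [genericMatrix, entryDeriv, MvPolynomial.pderiv_X, Pi.single_apply, *, ne_of_lt, ne_of_gt,
      not_lt_of_gt, smul_add, smul_sub, smul_smul]
  all_goals
    clear hs hs' hI₁ hI₂ hI₃
    split_ifs
  all_goals first | (exfalso; grind) | module

/-- The product rule cuts the power at the differentiated factor; this cut is the source of the
splitting term. -/
theorem entryDeriv_genericMatrix_pow (i j : Fin N) (p : ℕ) (k l : Fin N) :
    entryDeriv i j ((genericMatrix N ^ p) k l) =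
      ∑ a ∈ Finset.range p, (genericMatrix N ^ a) k j * (genericMatrix N ^ (p - 1 - a)) i l := by
  induction p generalizing l with
  | zero =>
    rw [pow_zero, Matrix.one_apply]
    split_ifs <;> simp
  | succ p ih =>
    rw [pow_succ, Matrix.mul_apply, map_sum]
    simp only [Derivation.leibniz, ih, entryDeriv_genericMatrix, smul_eq_mul]
    rw [Finset.sum_add_distrib, Finset.sum_range_succ, add_comm]
    congr 1
    · simp only [Finset.mul_sum]
      rw [Finset.sum_comm]
      refine Finset.sum_congr rfl fun a ha => ?_
      have := Finset.mem_range.1 ha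
      rw [show p + 1 - 1 - a = (p - 1 - a) + 1 by omega, pow_succ _ (p - 1 - a), Matrix.mul_apply,
        Finset.mul_sum]
      exact Finset.sum_congr rfl fun m _ => by ring
    · rw [Nat.add_sub_cancel, Nat.sub_self, pow_zero, Matrix.one_apply]
      by_cases h : l = i
      · simp [h]
      · simp [h, Ne.symm h]

theorem entryDeriv_trace_pow (i j : Fin N) (q : ℕ) :
    entryDeriv i j (genericMatrix N ^ q).trace =
      (q : MvPolynomial (Fin N × Fin N) ℂ) * (genericMatrix N ^ (q - 1)) i j := by
  simp only [Matrix.trace, Matrix.diag_apply, map_sum, entryDeriv_genericMatrix_pow]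
  rw [Finset.sum_comm]
  have : ∀ a ∈ Finset.range q, ∑ k, (genericMatrix N ^ a) k j *
      (genericMatrix N ^ (q - 1 - a)) i k = (genericMatrix N ^ (q - 1)) i j := by
    intro a ha
    have := Finset.mem_range.1 ha
    rw [show q - 1 = (q - 1 - a) + a by omega, pow_add, Matrix.mul_apply]
    simp only [Nat.add_sub_cancel]
    exact Finset.sum_congr rfl fun m _ => by ring
  rw [Finset.sum_congr rfl this]
  simp

/-- The moments of the matrix model satisfy the loop equations. -/
theorem loopEquations_matrix (N : ℕ) :
    LoopEquations N fun s => gaussE (s.map fun q => (genericMatrix N ^ q).trace).prod where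
  zero := by simp [gaussE_one]
  cons_zero s := by
    simp only [Multiset.map_cons, Multiset.prod_cons, pow_zero, Matrix.trace_one,
      Fintype.card_fin]
    rw [← nsmul_eq_mul, map_nsmul, nsmul_eq_mul]
  cons_succ p s := by
    set T : ℕ → MvPolynomial (Fin N × Fin N) ℂ := fun q => (genericMatrix N ^ q).trace with hT
    set P := (s.map T).prod with hP
    have h1 : T (p + 1) = ∑ i, ∑ j, genericMatrix N i j * (genericMatrix N ^ p) j i := by
      simp only [hT, pow_succ', Matrix.trace, Matrix.diag_apply, Matrix.mul_apply]
    have h2 : ∑ i, ∑ j, entryDeriv i j ((genericMatrix N ^ p) j i * P) =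
        (∑ a ∈ Finset.range p, T a * (T (p - 1 - a) * P)) +
          (s.map fun q : ℕ => (q : ℂ) • (T (p + q - 1) * ((s.erase q).map T).prod)).sum := by
      -- The derivative falling on the matrix power yields the splitting terms.
      have h3 : ∑ i, ∑ j, entryDeriv i j ((genericMatrix N ^ p) j i) =
          ∑ a ∈ Finset.range p, T a * T (p - 1 - a) := by
        simp only [entryDeriv_genericMatrix_pow, hT, Matrix.trace, Matrix.diag_apply,
          Finset.sum_mul_sum]
        rw [Finset.sum_comm]
        simp only [Finset.sum_comm (s := Finset.univ) (t := Finset.range p)]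
      -- The derivative falling on the other traces is collected into one derivation, which sends
      -- the trace of the `q`-th power to `q` times that of the `(p + q - 1)`-th: the merging terms.
      let D : Derivation ℂ (MvPolynomial (Fin N × Fin N) ℂ) (MvPolynomial (Fin N × Fin N) ℂ) :=
        ∑ i, ∑ j, (genericMatrix N ^ p) j i • entryDeriv i j
      have hD : ∀ F, D F = ∑ i, ∑ j, (genericMatrix N ^ p) j i * entryDeriv i j F := by
        intro F
        simp [D, derivation_sum_apply]
      have h4 : ∀ q, D (T q) = (q : ℂ) • T (p + q - 1) := by
        intro q
        simp only [hD, hT, entryDeriv_trace_pow]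
        rcases Nat.eq_zero_or_pos q with rfl | hq
        · simp
        · rw [show p + q - 1 = p + (q - 1) by omega, pow_add, Matrix.trace, Finset.sum_comm,
            Finset.smul_sum]
          refine Finset.sum_congr rfl fun j _ => ?_
          rw [Matrix.diag_apply, Matrix.mul_apply, Finset.smul_sum]
          refine Finset.sum_congr rfl fun i _ => ?_
          rw [Nat.cast_smul_eq_nsmul, nsmul_eq_mul]
          ring
      simp only [Derivation.leibniz, smul_eq_mul, Finset.sum_add_distrib, ← Finset.mul_sum]
      rw [h3, ← hD, hP, derivation_multiset_prod, ← hP, add_comm, Finset.mul_sum]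
      simp only [h4, smul_mul_assoc]
      congr 1
      exact Finset.sum_congr rfl fun a _ => by ring
    simp only [Multiset.map_cons, Multiset.prod_cons]
    rw [← hP, h1, Finset.sum_mul, map_sum]
    simp only [Finset.sum_mul, map_sum, mul_assoc, gaussE_genericMatrix_mul]
    simp only [← Finset.sum_div, ← map_sum]
    rw [h2, map_add, map_sum, map_multiset_sum, Multiset.map_map]
    simp

end MatrixSide

/-! ### Loop equations for the squared Vandermonde weight. -/

section EigenvalueSide

variable {N : ℕ}

/-- The Vandermonde product `∏_{i < j} (x_j - x_i)`. -/
def vandermondePoly (N : ℕ) : MvPolynomial (Fin N) ℂ :=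
  ∏ i, ∏ j ∈ Finset.Ioi i, (MvPolynomial.X j - MvPolynomial.X i)

theorem derivation_finset_prod {ι A : Type*} [CommRing A] [Algebra ℂ A] (D : Derivation ℂ A A)
    (s : Finset ι) (f g : ι → A) (h : ∀ i ∈ s, D (f i) = f i * g i) :
    D (∏ i ∈ s, f i) = (∏ i ∈ s, f i) * ∑ i ∈ s, g i := by
  classical
  induction s using Finset.induction with
  | empty => simp
  | insert a s ha ih =>
    rw [Finset.prod_insert ha, Finset.sum_insert ha, D.leibniz, h a (Finset.mem_insert_self a s),
      ih fun i hi => h i (Finset.mem_insert_of_mem hi)]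
    simp only [smul_eq_mul]
    ring

/-- The vector field `∑_i x_i ^ p ∂_i`. -/
def wittDeriv (N p : ℕ) : Derivation ℂ (MvPolynomial (Fin N) ℂ) (MvPolynomial (Fin N) ℂ) :=
  ∑ i, (MvPolynomial.X i : MvPolynomial (Fin N) ℂ) ^ p • MvPolynomial.pderiv i

theorem wittDeriv_apply (p : ℕ) (F : MvPolynomial (Fin N) ℂ) :
    wittDeriv N p F = ∑ i, MvPolynomial.X i ^ p * MvPolynomial.pderiv i F := by
  simp [wittDeriv, derivation_sum_apply]

theorem wittDeriv_X (p : ℕ) (j : Fin N) :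
    wittDeriv N p (MvPolynomial.X j) = MvPolynomial.X j ^ p := by
  simp [wittDeriv_apply, MvPolynomial.pderiv_X, Pi.single_apply]

theorem wittDeriv_psum (p q : ℕ) :
    wittDeriv N p (MvPolynomial.psum (Fin N) ℂ q) =
      (q : ℂ) • MvPolynomial.psum (Fin N) ℂ (p + q - 1) := by
  rw [MvPolynomial.psum, map_sum, MvPolynomial.psum, Finset.smul_sum]
  refine Finset.sum_congr rfl fun i _ => ?_
  rw [Derivation.leibniz_pow, wittDeriv_X, smul_eq_mul, ← pow_add, Nat.cast_smul_eq_nsmul]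
  rcases Nat.eq_zero_or_pos q with rfl | hq
  · simp
  · congr 2
    omega

/-- Each factor `x_j - x_i` is sent to `x_j^p - x_i^p`, a multiple of itself by a geometric sum, so
the logarithmic derivative is polynomial. -/
theorem wittDeriv_vandermondePoly (p : ℕ) :
    wittDeriv N p (vandermondePoly N) = vandermondePoly N * ∑ i, ∑ j ∈ Finset.Ioi i,
      ∑ a ∈ Finset.range p, MvPolynomial.X j ^ a * MvPolynomial.X i ^ (p - 1 - a) := by
  refine derivation_finset_prod _ _ _ _ fun i _ => derivation_finset_prod _ _ _ _ fun j _ => ?_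
  rw [Derivation.map_sub, wittDeriv_X, wittDeriv_X, mul_comm, (Commute.all _ _).geom_sum₂_mul]

/-- The left side sums the geometric sum over all ordered pairs. The diagonal is the divergence of
`∑ x_i^p ∂_i`; by symmetry the rest is twice the sum over `i < j`, the logarithmic derivative of the
squared Vandermonde. -/
theorem sum_psum_mul_psum (p : ℕ) :
    ∑ a ∈ Finset.range p, MvPolynomial.psum (Fin N) ℂ a * MvPolynomial.psum (Fin N) ℂ (p - 1 - a) =
      (∑ i, (p : MvPolynomial (Fin N) ℂ) * MvPolynomial.X i ^ (p - 1)) +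
        2 * ∑ i, ∑ j ∈ Finset.Ioi i,
          ∑ a ∈ Finset.range p, MvPolynomial.X j ^ a * MvPolynomial.X i ^ (p - 1 - a) := by
  let h : Fin N → Fin N → MvPolynomial (Fin N) ℂ := fun j i =>
    ∑ a ∈ Finset.range p, MvPolynomial.X j ^ a * MvPolynomial.X i ^ (p - 1 - a)
  have hsymm : ∀ i j, h i j = h j i := by
    intro i j
    simp only [h]
    rw [← Finset.sum_range_reflect]
    refine Finset.sum_congr rfl fun a ha => ?_
    have := Finset.mem_range.1 ha
    rw [show p - 1 - (p - 1 - a) = a by omega, mul_comm]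
  have hdiag : ∀ i, h i i = (p : MvPolynomial (Fin N) ℂ) * MvPolynomial.X i ^ (p - 1) := by
    intro i
    have : ∀ a ∈ Finset.range p, (MvPolynomial.X i : MvPolynomial (Fin N) ℂ) ^ a *
        MvPolynomial.X i ^ (p - 1 - a) = MvPolynomial.X i ^ (p - 1) := by
      intro a ha
      have := Finset.mem_range.1 ha
      rw [← pow_add]
      congr 1
      omega
    simp only [h]
    rw [Finset.sum_congr rfl this]
    simp
  have hoff := Finset.sum_sum_Ioi_add_eq_sum_sum_off_diag h
  have hall : ∑ a ∈ Finset.range p, MvPolynomial.psum (Fin N) ℂ a *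
      MvPolynomial.psum (Fin N) ℂ (p - 1 - a) = ∑ i, ∑ j, h j i := by
    simp only [MvPolynomial.psum, Finset.sum_mul_sum, h]
    rw [Finset.sum_comm]
    rw [Finset.sum_comm (s := Finset.univ) (t := Finset.univ)]
    refine Finset.sum_congr rfl fun i _ => ?_
    rw [Finset.sum_comm]
  rw [hall]
  have : ∀ i, ∑ j, h j i = h i i + ∑ j ∈ {i}ᶜ, h j i := fun i =>
    Fintype.sum_eq_add_sum_compl i _
  simp only [this, Finset.sum_add_distrib, hdiag]
  rw [← hoff, Finset.mul_sum]
  congr 1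
  refine Finset.sum_congr rfl fun i _ => ?_
  rw [Finset.mul_sum]
  refine Finset.sum_congr rfl fun j _ => ?_
  rw [hsymm i j, two_mul]

/-- The moments of the eigenvalue density satisfy the loop equations. -/
theorem loopEquations_eigenvalue (hZ : gaussE (vandermondePoly N ^ 2) ≠ 0) :
    LoopEquations N fun s =>
      gaussE ((s.map fun q => MvPolynomial.psum (Fin N) ℂ q).prod * vandermondePoly N ^ 2) /
        gaussE (vandermondePoly N ^ 2) where
  zero := by simp [hZ]
  cons_zero s := by
    simp only [Multiset.map_cons, Multiset.prod_cons, MvPolynomial.psum_zero, Fintype.card_fin]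
    rw [mul_assoc, ← nsmul_eq_mul, map_nsmul, nsmul_eq_mul, mul_div_assoc]
  cons_succ p s := by
    set T : ℕ → MvPolynomial (Fin N) ℂ := fun q => MvPolynomial.psum (Fin N) ℂ q with hT
    set P := (s.map T).prod with hP
    set V := vandermondePoly N with hV
    have h1 : T (p + 1) * P * V ^ 2 =
        ∑ i, MvPolynomial.X i * (MvPolynomial.X i ^ p * (P * V ^ 2)) := by
      simp only [hT, MvPolynomial.psum, Finset.sum_mul]
      exact Finset.sum_congr rfl fun i _ => by ring
    -- Derivatives of `x_i^p` and of `V²` together give the splitting terms, those of `P` the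
    -- merging terms.
    have h2 : ∑ i, MvPolynomial.pderiv i (MvPolynomial.X i ^ p * (P * V ^ 2)) =
        (∑ a ∈ Finset.range p, T a * (T (p - 1 - a) * P) * V ^ 2) +
          (s.map fun q : ℕ =>
            (q : ℂ) • (T (p + q - 1) * ((s.erase q).map T).prod * V ^ 2)).sum := by
      have e1 : ∀ i, MvPolynomial.pderiv i (MvPolynomial.X i ^ p * (P * V ^ 2)) =
          MvPolynomial.X i ^ p * MvPolynomial.pderiv i (P * V ^ 2) +
            (p : MvPolynomial (Fin N) ℂ) * MvPolynomial.X i ^ (p - 1) * (P * V ^ 2) := by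
        intro i
        rw [Derivation.leibniz, Derivation.leibniz_pow, MvPolynomial.pderiv_X_self]
        simp only [smul_eq_mul, nsmul_eq_mul]
        ring
      have e2 : wittDeriv N p (P * V ^ 2) = (wittDeriv N p P) * V ^ 2 +
          P * V ^ 2 * (2 * ∑ i, ∑ j ∈ Finset.Ioi i,
          ∑ a ∈ Finset.range p, MvPolynomial.X j ^ a * MvPolynomial.X i ^ (p - 1 - a)) := by
        rw [Derivation.leibniz, Derivation.leibniz_pow, hV, wittDeriv_vandermondePoly]
        simp only [smul_eq_mul, nsmul_eq_mul]
        push_cast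
        ring
      simp only [e1, Finset.sum_add_distrib]
      rw [← wittDeriv_apply, e2, hP, derivation_multiset_prod, ← hP]
      have e3 : ∑ a ∈ Finset.range p, T a * (T (p - 1 - a) * P) * V ^ 2 =
          (∑ a ∈ Finset.range p, T a * T (p - 1 - a)) * (P * V ^ 2) := by
        rw [Finset.sum_mul]
        exact Finset.sum_congr rfl fun i _ => by ring
      rw [e3, sum_psum_mul_psum, ← Multiset.sum_map_mul_right, ← Finset.sum_mul]
      simp only [hT, wittDeriv_psum, smul_mul_assoc]
      ring
    simp only [Multiset.map_cons, Multiset.prod_cons]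
    rw [← hP, h1, map_sum]
    simp only [gaussE_X_mul]
    rw [← Finset.sum_div, ← map_sum, h2, map_add, map_sum, map_multiset_sum, Multiset.map_map]
    simp only [Function.comp_def, map_smul, smul_eq_mul, ← Finset.sum_div, ← mul_div_assoc,
      Multiset.sum_map_div]
    ring

end EigenvalueSide

/-! ### Andréief's identity and second moments of power traces. -/

section Determinantal

variable {N : ℕ}

/-- The matrix of multiplication by `f`, compressed to polynomials of degree less than `N`, in the
basis of Hermite polynomials. -/
def compression (N : ℕ) (f : ℂ[X]) : Matrix (Fin N) (Fin N) ℂ :=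
  Matrix.of fun i k => gaussExp 0 (hermitePoly i * f * hermitePoly k) / hermiteNormSq i

theorem compression_one (N : ℕ) : compression N 1 = 1 := by
  ext i k
  simp only [compression, Matrix.of_apply, mul_one, gaussExp_zero_hermitePoly_mul,
    Matrix.one_apply, Fin.val_inj]
  split_ifs with h
  · exact div_self (hermiteNormSq_ne_zero _)
  · exact zero_div _

/-- Monomials may be replaced by monic polynomials of the same degrees without changing the
determinant; the Hermite choice makes the compression of `1` the identity. -/
theorem vandermondePoly_eq_sum (N : ℕ) :
    vandermondePoly N = ∑ σ : Equiv.Perm (Fin N), ((Equiv.Perm.sign σ : ℤ) : ℂ) •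
      ∏ j, aeval (MvPolynomial.X j : MvPolynomial (Fin N) ℂ) (hermitePoly (σ j)) := by
  have h := Matrix.det_eval_matrixOfPolynomials_eq_det_vandermonde
    (fun i => (MvPolynomial.X i : MvPolynomial (Fin N) ℂ))
    (fun i => (hermitePoly i).map (algebraMap ℂ (MvPolynomial (Fin N) ℂ)))
    (fun i => by
      rw [(hermitePoly_monic_natDegree i).1.natDegree_map, (hermitePoly_monic_natDegree i).2])
    (fun i => (hermitePoly_monic_natDegree i).1.map _)
  rw [vandermondePoly, ← Matrix.det_vandermonde, h, ← Matrix.det_transpose, Matrix.det_apply']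
  refine Finset.sum_congr rfl fun σ _ => ?_
  rw [MvPolynomial.smul_eq_C_mul]
  simp only [Matrix.transpose_apply, Matrix.of_apply, eval_map_algebraMap]
  simp

/-- The Andréief identity for the Gaussian weight and a product of one-variable polynomials. -/
theorem gaussE_prod_mul_vandermondePoly_sq (w : Fin N → ℂ[X]) :
    gaussE ((∏ j, aeval (MvPolynomial.X j : MvPolynomial (Fin N) ℂ) (w j)) *
        vandermondePoly N ^ 2) =
      (∏ i : Fin N, hermiteNormSq i) * ∑ σ : Equiv.Perm (Fin N),
        (Matrix.of fun k i => compression N (w (σ k)) k i).det := by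
  have h1 : ∀ σ τ : Equiv.Perm (Fin N),
      gaussE ((∏ j, aeval (MvPolynomial.X j : MvPolynomial (Fin N) ℂ) (w j)) *
        ((∏ j, aeval (MvPolynomial.X j : MvPolynomial (Fin N) ℂ) (hermitePoly (σ j))) *
        ∏ j, aeval (MvPolynomial.X j : MvPolynomial (Fin N) ℂ) (hermitePoly (τ j)))) =
      (∏ i : Fin N, hermiteNormSq i) * ∏ j, compression N (w j) (σ j) (τ j) := by
    intro σ τ
    rw [← Equiv.prod_comp σ fun i : Fin N => hermiteNormSq i]
    simp only [← Finset.prod_mul_distrib, ← map_mul]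
    rw [gaussE_prod]
    refine Finset.prod_congr rfl fun j _ => ?_
    rw [compression, Matrix.of_apply, mul_div_cancel₀ _ (hermiteNormSq_ne_zero _)]
    congr 1
    ring
  rw [sq, vandermondePoly_eq_sum, Finset.sum_mul_sum, Finset.mul_sum, map_sum, Finset.mul_sum,
    ← Equiv.sum_comp (Equiv.inv _)]
  refine Finset.sum_congr rfl fun σ _ => ?_
  simp only [Equiv.inv_apply, Finset.mul_sum, map_sum, smul_mul_smul_comm]
  simp only [mul_smul_comm, map_smul, h1, smul_eq_mul]
  -- Permuting rows absorbs the outer sign, so that the inner sum over `τ` is a determinant.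
  have h2 := Matrix.det_permute σ⁻¹ (Matrix.of fun k i => compression N (w (σ k)) k i)
  have h3 : (Matrix.of fun k i => compression N (w (σ k)) k i).det =
      ((Equiv.Perm.sign σ⁻¹ : ℤ) : ℂ) *
        ((Matrix.of fun k i => compression N (w (σ k)) k i).submatrix (σ⁻¹ : Equiv.Perm _) id).det := by
    rw [h2, ← mul_assoc, ← Int.cast_mul, ← Units.val_mul, Int.units_mul_self]
    simp
  rw [h3, ← Matrix.det_transpose, Matrix.det_apply', Finset.mul_sum, Finset.mul_sum]
  refine Finset.sum_congr rfl fun τ _ => ?_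
  simp only [Matrix.transpose_apply, Matrix.submatrix_apply, Matrix.of_apply, id]
  simp only [Equiv.Perm.inv_def, Equiv.apply_symm_apply]
  ring

/-- A rank-two perturbation of the identity: `det(1 + AB) = det(1 + BA)` reduces it to a two-by-two
determinant. -/
theorem det_one_updateRow_updateRow {n : Type*} [Fintype n] [DecidableEq n] {a b : n} (hab : a ≠ b)
    (u v : n → ℂ) :
    (((1 : Matrix n n ℂ).updateRow a u).updateRow b v).det = u a * v b - u b * v a := by
  let A : Matrix n (Fin 2) ℂ := Matrix.of fun k => ![if k = a then 1 else 0, if k = b then 1 else 0]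
  let B : Matrix (Fin 2) n ℂ := Matrix.of
    ![fun i => u i - (1 : Matrix n n ℂ) a i, fun i => v i - (1 : Matrix n n ℂ) b i]
  have h : ((1 : Matrix n n ℂ).updateRow a u).updateRow b v = 1 + A * B := by
    ext k i
    simp only [Matrix.updateRow_apply, Matrix.add_apply, Matrix.mul_apply, Fin.sum_univ_two, A, B,
      Matrix.of_apply, Matrix.cons_val_zero, Matrix.cons_val_one]
    by_cases hb : k = b
    · subst hb
      simp [hab.symm]
    · by_cases ha : k = a
      · subst ha
        simp [hb]
      · simp [ha, hb]
  rw [h, Matrix.det_one_add_mul_comm, Matrix.det_fin_two]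
  simp only [Matrix.add_apply, Matrix.mul_apply, A, B, Matrix.of_apply, Matrix.cons_val_zero,
    Matrix.cons_val_one]
  simp [Matrix.one_apply, hab, hab.symm]

theorem det_one_updateRow {n : Type*} [Fintype n] [DecidableEq n] (a : n) (u : n → ℂ) :
    ((1 : Matrix n n ℂ).updateRow a u).det = u a := by
  rw [← Matrix.cramer_transpose_apply]
  simp

/-- Rows other than `a` and `b` are those of the identity. For `a = b` the last bracket vanishes, so
one formula covers all pairs. -/
theorem det_compression_pair (f g : ℂ[X]) (a b : Fin N) :
    (Matrix.of fun k i => compression N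
        ((if k = a then f else 1) * (if k = b then g else 1)) k i).det =
      (if a = b then compression N (f * g) a a else 0) +
        (compression N f a a * compression N g b b -
          compression N f a b * compression N g b a) := by
  by_cases hab : a = b
  · subst hab
    have : (Matrix.of fun k i => compression N
        ((if k = a then f else 1) * (if k = a then g else 1)) k i) =
        (1 : Matrix _ _ ℂ).updateRow a (compression N (f * g) a) := by
      ext k i
      rw [Matrix.of_apply, Matrix.updateRow_apply]
      by_cases hk : k = a
      · rw [if_pos hk, if_pos hk, if_pos hk, hk]
      · rw [if_neg hk, if_neg hk, if_neg hk, mul_one, compression_one]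
    rw [this, det_one_updateRow, if_pos rfl, sub_self, add_zero]
  · have : (Matrix.of fun k i => compression N
        ((if k = a then f else 1) * (if k = b then g else 1)) k i) =
        ((1 : Matrix _ _ ℂ).updateRow a (compression N f a)).updateRow b
          (compression N g b) := by
      ext k i
      rw [Matrix.of_apply, Matrix.updateRow_apply, Matrix.updateRow_apply]
      by_cases hb : k = b
      · rw [if_neg fun h => hab (h.symm.trans hb), if_pos hb, if_pos hb, one_mul, hb]
      · by_cases ha : k = a
        · rw [if_pos ha, if_neg hb, if_neg hb, if_pos ha, mul_one, ha]
        · rw [if_neg ha, if_neg hb, if_neg hb, if_neg ha, mul_one, compression_one]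
    rw [this, det_one_updateRow_updateRow hab, if_neg hab, zero_add]

theorem gaussE_sum_mul_sum_mul_vandermondePoly_sq (f g : ℂ[X]) :
    gaussE ((∑ a, aeval (MvPolynomial.X a : MvPolynomial (Fin N) ℂ) f) *
        (∑ b, aeval (MvPolynomial.X b : MvPolynomial (Fin N) ℂ) g) * vandermondePoly N ^ 2) =
      (∏ i : Fin N, hermiteNormSq i) * (N ! : ℂ) *
        ((compression N (f * g)).trace +
          ∑ a, ∑ b, (compression N f a a * compression N g b b -
            compression N f a b * compression N g b a)) := by
  let w : Fin N → Fin N → Fin N → ℂ[X] := fun a b j =>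
    (if j = a then f else 1) * (if j = b then g else 1)
  have h1 : (∑ a, aeval (MvPolynomial.X a : MvPolynomial (Fin N) ℂ) f) *
      (∑ b, aeval (MvPolynomial.X b : MvPolynomial (Fin N) ℂ) g) =
      ∑ a, ∑ b, ∏ j, aeval (MvPolynomial.X j : MvPolynomial (Fin N) ℂ) (w a b j) := by
    rw [Finset.sum_mul_sum]
    refine Finset.sum_congr rfl fun a _ => Finset.sum_congr rfl fun b _ => ?_
    simp only [w, map_mul, Finset.prod_mul_distrib, apply_ite (aeval _), map_one]
    simp
  have h2 : ∀ a b, (Matrix.of fun k i => compression N (w a b k) k i).det =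
      (if a = b then compression N (f * g) a a else 0) +
        (compression N f a a * compression N g b b -
          compression N f a b * compression N g b a) := det_compression_pair f g
  rw [h1]
  simp only [Finset.sum_mul, map_sum, gaussE_prod_mul_vandermondePoly_sq, ← Finset.mul_sum]
  rw [mul_assoc]
  congr 1
  have h3 : ∀ σ : Equiv.Perm (Fin N), ∑ a, ∑ b,
      (Matrix.of fun k i => compression N (w a b (σ k)) k i).det =
      (compression N (f * g)).trace +
          ∑ a, ∑ b, (compression N f a a * compression N g b b -
            compression N f a b * compression N g b a) := by
    intro σ
    -- Relabelling `a` and `b` by `σ` removes `σ`, so all `N!` permutations contribute equally.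
    have hw : ∀ a b k, w (σ a) (σ b) (σ k) = w a b k := by
      intro a b k
      simp only [w, EmbeddingLike.apply_eq_iff_eq]
    have hσ : ∀ a, ∑ b, (Matrix.of fun k i => compression N (w (σ a) b (σ k)) k i).det =
        ∑ b, (Matrix.of fun k i => compression N (w a b k) k i).det := by
      intro a
      rw [← Equiv.sum_comp σ]
      simp only [hw]
    rw [← Equiv.sum_comp σ]
    simp only [hσ, h2, Finset.sum_add_distrib, Finset.sum_ite_eq, Finset.mem_univ, if_true]
    rfl
  have h4 : ∀ F : Fin N → Fin N → Equiv.Perm (Fin N) → ℂ,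
      ∑ a, ∑ b, ∑ σ, F a b σ = ∑ σ, ∑ a, ∑ b, F a b σ := by
    intro F
    rw [Finset.sum_comm (s := Finset.univ (α := Equiv.Perm (Fin N)))]
    exact Finset.sum_congr rfl fun a _ => Finset.sum_comm
  rw [h4, Finset.sum_congr rfl fun σ _ => h3 σ, Finset.sum_const, nsmul_eq_mul,
    Finset.card_univ, Fintype.card_perm, Fintype.card_fin]

theorem gaussE_vandermondePoly_sq (N : ℕ) : gaussE (vandermondePoly N ^ 2) =
    (∏ i : Fin N, hermiteNormSq i) * (N ! : ℂ) := by
  have h := gaussE_prod_mul_vandermondePoly_sq (N := N) fun _ => 1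
  have h1 : (Matrix.of fun k i => compression N 1 k i).det = 1 := by
    rw [compression_one]
    exact Matrix.det_one
  rw [h1] at h
  simpa [Fintype.card_perm] using h

theorem gaussE_vandermondePoly_sq_ne_zero (N : ℕ) : gaussE (vandermondePoly N ^ 2) ≠ 0 := by
  rw [gaussE_vandermondePoly_sq]
  refine mul_ne_zero (Finset.prod_ne_zero_iff.2 fun i _ => hermiteNormSq_ne_zero i) ?_
  exact_mod_cast N.factorial_ne_zero

/-- The second mixed moments of power traces of the GUE. -/
theorem gaussE_trace_pow_mul_trace_pow (N p q : ℕ) :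
    gaussE ((genericMatrix N ^ p).trace * (genericMatrix N ^ q).trace) =
      (compression N (X ^ p * X ^ q)).trace +
        ∑ a, ∑ b, (compression N (X ^ p) a a * compression N (X ^ q) b b -
          compression N (X ^ p) a b * compression N (X ^ q) b a) := by
  have hZ := gaussE_vandermondePoly_sq_ne_zero N
  -- Uniqueness of loop equations takes the place of the Weyl integration formula.
  have h := congrFun ((loopEquations_matrix N).unique (loopEquations_eigenvalue hZ)) {p, q}
  simp only [Multiset.insert_eq_cons, Multiset.map_cons, Multiset.map_singleton,
    Multiset.prod_cons, Multiset.prod_singleton] at h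
  have h' := gaussE_sum_mul_sum_mul_vandermondePoly_sq (N := N) (X ^ p) (X ^ q)
  rw [← gaussE_vandermondePoly_sq] at h'
  simp only [map_pow, aeval_X] at h'
  rw [h, div_eq_iff hZ, mul_comm _ (gaussE _), ← h']
  rfl

end Determinantal

/-! ### From power traces to exponential statistics. -/

section Spectral

variable {N : ℕ}

theorem trace_matrix_pow (x : Fin N × Fin N → ℝ) (p : ℕ) :
    (matrix x ^ p).trace = ∑ j, (eigenvalue x j : ℂ) ^ p := by
  have h := (matrix_isHermitian x).spectral_theorem
  conv_lhs => rw [h, ← map_pow, Unitary.conjStarAlgAut_apply, Matrix.trace_mul_cycle]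
  rw [Unitary.coe_star_mul_self, one_mul, Matrix.diagonal_pow, Matrix.trace_diagonal]
  rfl

theorem aeval_trace_genericMatrix_pow (x : Fin N × Fin N → ℝ) (p : ℕ) :
    MvPolynomial.aeval (fun e => (x e : ℂ)) (genericMatrix N ^ p).trace =
      ∑ j, (eigenvalue x j : ℂ) ^ p := by
  rw [← trace_matrix_pow, ← aeval_genericMatrix]
  have h := map_pow (MvPolynomial.aeval (R := ℂ) fun e => (x e : ℂ)).mapMatrix (genericMatrix N) p
  simp only [AlgHom.mapMatrix_apply] at h
  rw [← h]
  simp [Matrix.trace]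

theorem matrix_mul_matrix_swap (x : Fin N × Fin N → ℝ) (i j : Fin N) :
    matrix x i j * matrix x j i = (((x (i, j)) ^ 2 + (x (j, i)) ^ 2) / 2 : ℝ) := by
  have hs : (Real.sqrt 2 : ℂ) ^ 2 = 2 := by
    rw [← Complex.ofReal_pow, Real.sq_sqrt (by norm_num)]; simp
  have hs0 : (Real.sqrt 2 : ℂ) ≠ 0 := by
    intro h; rw [h] at hs; norm_num at hs
  push_cast
  rcases lt_trichotomy i j with h | rfl | h
  · simp only [matrix, Matrix.of_apply, h.ne, h.ne', h, h.not_gt, if_true, if_false]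
    field_simp
    rw [hs]
    linear_combination (-2 * (x (j, i) : ℂ) ^ 2) * Complex.I_sq
  · simp only [matrix, Matrix.of_apply, if_true]
    ring
  · simp only [matrix, Matrix.of_apply, h.ne, h.ne', h, h.not_gt, if_true, if_false]
    field_simp
    rw [hs]
    linear_combination (-2 * (x (i, j) : ℂ) ^ 2) * Complex.I_sq

theorem sum_sq_eigenvalue (x : Fin N × Fin N → ℝ) :
    ∑ j, eigenvalue x j ^ 2 = ∑ e, x e ^ 2 := by
  have h := trace_matrix_pow x 2
  rw [sq, Matrix.trace] at h
  simp only [Matrix.diag_apply, Matrix.mul_apply, matrix_mul_matrix_swap] at h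
  have h' : ∑ i, ∑ j, (x (i, j) ^ 2 + x (j, i) ^ 2) / 2 = ∑ j, eigenvalue x j ^ 2 := by
    exact_mod_cast h
  rw [← h', Fintype.sum_prod_type]
  simp only [add_div, Finset.sum_add_distrib]
  rw [Finset.sum_comm (f := fun i j => x (j, i) ^ 2 / 2)]
  simp only [← Finset.sum_div]
  ring

/-- This bound by the coordinates supplies the integrable majorants for the exponential statistics.
-/
theorem abs_eigenvalue_le (x : Fin N × Fin N → ℝ) (j : Fin N) :
    |eigenvalue x j| ≤ ∑ e, |x e| := by
  refine abs_le_of_sq_le_sq ?_ (Finset.sum_nonneg fun e _ => abs_nonneg _)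
  calc eigenvalue x j ^ 2 ≤ ∑ j, eigenvalue x j ^ 2 :=
        Finset.single_le_sum (f := fun j => eigenvalue x j ^ 2) (fun i _ => sq_nonneg _)
          (Finset.mem_univ j)
    _ = ∑ e, |x e| ^ 2 := by simp only [sum_sq_eigenvalue, sq_abs]
    _ ≤ (∑ e, |x e|) ^ 2 := Finset.sum_sq_le_sq_sum_of_nonneg fun e _ => abs_nonneg _

theorem integrable_exp_sum_abs {σ : Type*} [Fintype σ] (c : ℝ) :
    Integrable (fun x : σ → ℝ => Real.exp (c * ∑ e, |x e|)) (Measure.pi fun _ => coordLaw) := by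
  simp only [Finset.mul_sum, Real.exp_sum]
  refine Integrable.fintype_prod (f := fun _ (t : ℝ) => Real.exp (c * |t|)) fun _ => ?_
  simpa using integrable_pow_abs_mul_exp_abs 0 c

instance : IsProbabilityMeasure (measure N) := by
  unfold measure
  infer_instance

theorem norm_sum_pow_eigenvalue_le (x : Fin N × Fin N → ℝ) (p : ℕ) :
    ‖∑ j, (eigenvalue x j : ℂ) ^ p‖ ≤ N * (∑ e, |x e|) ^ p := by
  refine (norm_sum_le _ _).trans ?_
  have : ∀ j ∈ Finset.univ, ‖(eigenvalue x j : ℂ) ^ p‖ ≤ (∑ e, |x e|) ^ p := by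
    intro j _
    rw [norm_pow, Complex.norm_real, Real.norm_eq_abs]
    exact pow_le_pow_left₀ (abs_nonneg _) (abs_eigenvalue_le x j) p
  refine (Finset.sum_le_sum this).trans ?_
  simp

theorem norm_expStat_le (k : ℂ) (x : Fin N × Fin N → ℝ) :
    ‖expStat N k x‖ ≤ N * Real.exp (‖k‖ * ∑ e, |x e|) := by
  refine (norm_sum_le _ _).trans ?_
  have : ∀ j ∈ Finset.univ, ‖Complex.exp (Complex.I * k * (eigenvalue x j : ℂ))‖ ≤
      Real.exp (‖k‖ * ∑ e, |x e|) := by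
    intro j _
    refine (norm_exp_mul_ofReal_le _ _).trans (Real.exp_le_exp.2 ?_)
    rw [norm_mul, Complex.norm_I, one_mul]
    exact mul_le_mul_of_nonneg_left (abs_eigenvalue_le x j) (norm_nonneg _)
  refine (Finset.sum_le_sum this).trans ?_
  simp

theorem hasSum_cexp (z : ℂ) : HasSum (fun n : ℕ => z ^ n / (n ! : ℂ)) (Complex.exp z) := by
  rw [Complex.exp_eq_exp_ℂ]
  exact NormedSpace.expSeries_div_hasSum_exp z

theorem hasSum_rexp (z : ℝ) : HasSum (fun n : ℕ => z ^ n / (n ! : ℝ)) (Real.exp z) := by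
  rw [Real.exp_eq_exp_ℝ]
  exact NormedSpace.expSeries_div_hasSum_exp z

theorem hasSum_mul_of_hasSum {f g : ℕ → ℂ} {s t : ℂ} (hf : HasSum f s) (hg : HasSum g t) :
    HasSum (fun pq : ℕ × ℕ => f pq.1 * g pq.2) (s * t) :=
  hf.mul hg (summable_mul_of_summable_norm hf.summable.norm hg.summable.norm)

theorem hasSum_expStat (k : ℂ) (x : Fin N × Fin N → ℝ) :
    HasSum (fun p : ℕ => (Complex.I * k) ^ p / (p ! : ℂ) * ∑ j, (eigenvalue x j : ℂ) ^ p)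
      (expStat N k x) := by
  have h := hasSum_sum (s := Finset.univ) fun (j : Fin N) _ =>
    hasSum_cexp (Complex.I * k * (eigenvalue x j : ℂ))
  refine h.congr_fun fun p => ?_
  rw [Finset.mul_sum]
  exact Finset.sum_congr rfl fun j _ => by rw [mul_pow]; ring

/-- Measurability of individual eigenvalues is not needed: the statistic is a pointwise limit of
combinations of power traces, which are polynomials in the coordinates. -/
theorem aestronglyMeasurable_expStat (k : ℂ) :
    AEStronglyMeasurable (expStat N k) (measure N) := by
  refine aestronglyMeasurable_of_tendsto_ae Filter.atTop
    (f := fun n x => ∑ p ∈ Finset.range n, (Complex.I * k) ^ p / (p ! : ℂ) *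
      ∑ j, (eigenvalue x j : ℂ) ^ p) (fun n => ?_)
    (Filter.Eventually.of_forall fun x => (hasSum_expStat k x).tendsto_sum_nat)
  refine Finset.aestronglyMeasurable_fun_sum _ fun p _ => ?_
  simp only [← aeval_trace_genericMatrix_pow]
  exact (integrable_aeval _).aestronglyMeasurable.const_mul _

theorem memLp_expStat (k : ℂ) : MemLp (expStat N k) 2 (measure N) := by
  have h : MemLp (fun x : Fin N × Fin N → ℝ => (N : ℝ) * Real.exp (‖k‖ * ∑ e, |x e|)) 2
      (measure N) := by
    refine (memLp_two_iff_integrable_sq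
      ((integrable_exp_sum_abs ‖k‖).aestronglyMeasurable.const_mul _)).2 ?_
    have := (integrable_exp_sum_abs (σ := Fin N × Fin N) (2 * ‖k‖)).const_mul ((N : ℝ) ^ 2)
    refine this.congr (Filter.Eventually.of_forall fun x => ?_)
    simp only [mul_pow, ← Real.exp_nat_mul]
    push_cast
    ring_nf
  refine h.mono (aestronglyMeasurable_expStat k) (Filter.Eventually.of_forall fun x => ?_)
  exact (norm_expStat_le k x).trans (le_abs_self _)

/-- Termwise integration of a double exponential series by dominated convergence, used both on
matrix space and on the line. -/
theorem hasSum_integral_double_exp {Ω : Type*} [MeasurableSpace Ω] {μ : Measure Ω} (a b : ℂ)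
    (B R : Ω → ℝ) (u : ℕ × ℕ → Ω → ℂ) (f : Ω → ℂ)
    (hu : ∀ pq, AEStronglyMeasurable (u pq) μ)
    (hB : ∀ pq x, ‖u pq x‖ ≤ B x * (R x ^ pq.1 * R x ^ pq.2))
    (hintegrable : Integrable (fun x => B x * Real.exp ((‖a‖ + ‖b‖) * R x)) μ)
    (hsum : ∀ x, HasSum (fun pq : ℕ × ℕ =>
      a ^ pq.1 / (pq.1 ! : ℂ) * (b ^ pq.2 / (pq.2 ! : ℂ)) * u pq x) (f x)) :
    HasSum (fun pq : ℕ × ℕ =>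
      a ^ pq.1 / (pq.1 ! : ℂ) * (b ^ pq.2 / (pq.2 ! : ℂ)) * ∫ x, u pq x ∂μ) (∫ x, f x ∂μ) := by
  have hb : ∀ x, HasSum (fun pq : ℕ × ℕ => B x * ((‖a‖ * R x) ^ pq.1 / (pq.1 ! : ℝ) *
      ((‖b‖ * R x) ^ pq.2 / (pq.2 ! : ℝ)))) (B x * Real.exp ((‖a‖ + ‖b‖) * R x)) := by
    intro x
    rw [add_mul, Real.exp_add]
    exact ((hasSum_rexp _).mul (hasSum_rexp _) (summable_mul_of_summable_norm
      (hasSum_rexp _).summable.norm (hasSum_rexp _).summable.norm)).mul_left _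
  have h := hasSum_integral_of_dominated_convergence (μ := μ) (f := f)
    (F := fun pq x => a ^ pq.1 / (pq.1 ! : ℂ) * (b ^ pq.2 / (pq.2 ! : ℂ)) * u pq x)
    (fun pq x => B x * ((‖a‖ * R x) ^ pq.1 / (pq.1 ! : ℝ) *
      ((‖b‖ * R x) ^ pq.2 / (pq.2 ! : ℝ))))
    (fun pq => (hu pq).const_mul _)
    (fun pq => Filter.Eventually.of_forall fun x => by
      rw [norm_mul, norm_mul, norm_div, norm_div, norm_pow, norm_pow, Complex.norm_natCast,
        Complex.norm_natCast]
      refine (mul_le_mul_of_nonneg_left (hB pq x) (by positivity)).trans_eq ?_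
      rw [mul_pow, mul_pow]
      ring)
    (Filter.Eventually.of_forall fun x => (hb x).summable)
    (hintegrable.congr (Filter.Eventually.of_forall fun x => (hb x).tsum_eq.symm))
    (Filter.Eventually.of_forall hsum)
  simpa only [integral_const_mul] using h

theorem hasSum_gaussExp_add (a b : ℂ) (i k : ℕ) :
    HasSum (fun pq : ℕ × ℕ => a ^ pq.1 / (pq.1 ! : ℂ) * (b ^ pq.2 / (pq.2 ! : ℂ)) *
      gaussExp 0 (hermitePoly i * (X ^ pq.1 * X ^ pq.2) * hermitePoly k))
      (gaussExp (a + b) (hermitePoly i * hermitePoly k)) := by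
  set P : ℂ[X] := hermitePoly i * hermitePoly k with hP
  have h := hasSum_integral_double_exp (Ω := ℝ) (μ := coordLaw) a b
    (fun x => ‖P.eval (x : ℂ)‖) (fun x => |x|)
    (fun pq x => (x : ℂ) ^ pq.1 * (x : ℂ) ^ pq.2 * P.eval (x : ℂ))
    (fun x => P.eval (x : ℂ) * Complex.exp ((a + b) * x))
    (fun pq => by fun_prop)
    (fun pq x => by
      simp only [norm_mul, norm_pow, Complex.norm_real, Real.norm_eq_abs]
      exact le_of_eq (by ring))
    (integrable_norm_eval_mul_exp_abs P (‖a‖ + ‖b‖))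
    (fun x => by
      have h := (hasSum_mul_of_hasSum (hasSum_cexp (a * x)) (hasSum_cexp (b * x))).mul_left
        (P.eval (x : ℂ))
      rw [← Complex.exp_add, ← add_mul] at h
      refine h.congr_fun fun pq => ?_
      rw [mul_pow, mul_pow]
      ring)
  rw [gaussExp_apply]
  refine h.congr_fun fun pq => ?_
  rw [gaussExp_zero_apply]
  congr 2
  funext x
  simp only [hP, eval_mul, eval_pow, eval_X]
  ring

theorem hasSum_gaussExp (a : ℂ) (i k : ℕ) :
    HasSum (fun p : ℕ => a ^ p / (p ! : ℂ) *
      gaussExp 0 (hermitePoly i * X ^ p * hermitePoly k))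
      (gaussExp a (hermitePoly i * hermitePoly k)) := by
  have h := hasSum_gaussExp_add a 0 i k
  have hinj : Function.Injective fun p : ℕ => (p, 0) := fun p q h => by simpa using h
  rw [add_zero, ← hinj.hasSum_iff] at h
  · simpa [Function.comp_def] using h
  · rintro ⟨p, q⟩ hpq
    have : q ≠ 0 := by
      rintro rfl
      exact hpq ⟨p, rfl⟩
    simp [this]

/-- The second mixed moments of the exponential statistics. -/
theorem integral_expStat_mul_expStat (k l : ℂ) :
    ∫ x, expStat N k x * expStat N l x ∂(measure N) =
      ∑ i : Fin N, gaussExp (Complex.I * k + Complex.I * l) (hermitePoly i * hermitePoly i) /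
          hermiteNormSq i +
        ∑ i : Fin N, ∑ j : Fin N,
          (gaussExp (Complex.I * k) (hermitePoly i * hermitePoly i) / hermiteNormSq i *
            (gaussExp (Complex.I * l) (hermitePoly j * hermitePoly j) / hermiteNormSq j) -
          gaussExp (Complex.I * k) (hermitePoly i * hermitePoly j) / hermiteNormSq i *
            (gaussExp (Complex.I * l) (hermitePoly j * hermitePoly i) / hermiteNormSq j)) := by
  set a := Complex.I * k with ha
  set b := Complex.I * l with hb
  -- Both sides are expanded in the same double series; `gaussE_trace_pow_mul_trace_pow` identifies
  -- the terms.
  have h1 : HasSum (fun pq : ℕ × ℕ => a ^ pq.1 / (pq.1 ! : ℂ) * (b ^ pq.2 / (pq.2 ! : ℂ)) *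
      gaussE ((genericMatrix N ^ pq.1).trace * (genericMatrix N ^ pq.2).trace))
      (∫ x, expStat N k x * expStat N l x ∂(measure N)) := by
    refine hasSum_integral_double_exp (Ω := Fin N × Fin N → ℝ) a b (fun _ => (N : ℝ) * N)
      (fun x => ∑ e, |x e|)
      (fun pq x => MvPolynomial.aeval (fun e => (x e : ℂ))
        ((genericMatrix N ^ pq.1).trace * (genericMatrix N ^ pq.2).trace))
      (fun x => expStat N k x * expStat N l x)
      (fun pq => (integrable_aeval _).aestronglyMeasurable) (fun pq x => ?_)
      ((integrable_exp_sum_abs _).const_mul _) (fun x => ?_)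
    · simp only [map_mul, aeval_trace_genericMatrix_pow, norm_mul]
      calc _ ≤ (N * (∑ e, |x e|) ^ pq.1) * (N * (∑ e, |x e|) ^ pq.2) := by
            gcongr <;> exact norm_sum_pow_eigenvalue_le x _
        _ = _ := by ring
    · have h := hasSum_mul_of_hasSum (hasSum_expStat k x) (hasSum_expStat l x)
      convert! h using 2 with pq
      simp only [map_mul, aeval_trace_genericMatrix_pow]
      ring
  have h2 : ∀ i j : Fin N, HasSum (fun p : ℕ => a ^ p / (p ! : ℂ) * compression N (X ^ p) i j)
      (gaussExp a (hermitePoly i * hermitePoly j) / hermiteNormSq i) := fun i j => by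
    simpa only [compression, Matrix.of_apply, mul_div_assoc] using
      (hasSum_gaussExp a i j).div_const (hermiteNormSq i)
  have h3 : ∀ i j : Fin N, HasSum (fun p : ℕ => b ^ p / (p ! : ℂ) * compression N (X ^ p) i j)
      (gaussExp b (hermitePoly i * hermitePoly j) / hermiteNormSq i) := fun i j => by
    simpa only [compression, Matrix.of_apply, mul_div_assoc] using
      (hasSum_gaussExp b i j).div_const (hermiteNormSq i)
  have h4 : HasSum (fun pq : ℕ × ℕ => a ^ pq.1 / (pq.1 ! : ℂ) * (b ^ pq.2 / (pq.2 ! : ℂ)) *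
      (compression N (X ^ pq.1 * X ^ pq.2)).trace)
      (∑ i : Fin N, gaussExp (a + b) (hermitePoly i * hermitePoly i) / hermiteNormSq i) := by
    have := hasSum_sum (s := Finset.univ) fun (i : Fin N) _ =>
      (hasSum_gaussExp_add a b i i).div_const (hermiteNormSq i)
    simpa only [compression, Matrix.of_apply, Matrix.trace, Matrix.diag_apply, mul_div_assoc,
      Finset.mul_sum] using this
  have h5 := hasSum_sum (s := Finset.univ) fun (i : Fin N) _ =>
    hasSum_sum (s := Finset.univ) fun (j : Fin N) _ =>
      (hasSum_mul_of_hasSum (h2 i i) (h3 j j)).sub (hasSum_mul_of_hasSum (h2 i j) (h3 j i))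
  refine h1.unique ((h4.add h5).congr_fun fun pq => ?_)
  rw [gaussE_trace_pow_mul_trace_pow, mul_add, Finset.mul_sum]
  congr 1
  refine Finset.sum_congr rfl fun i _ => ?_
  rw [Finset.mul_sum]
  exact Finset.sum_congr rfl fun j _ => by ring

end Spectral

/-! ### The covariance as a finite sum and its telescoping structure. -/

section Covariance

variable {N : ℕ}

theorem expStat_zero (x : Fin N × Fin N → ℝ) : expStat N 0 x = N := by
  simp [expStat]

theorem avg_expStat (k : ℂ) :
    avg N (expStat N k) =
      ∑ i : Fin N, gaussExp (Complex.I * k) (hermitePoly i * hermitePoly i) /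
        hermiteNormSq i := by
  rcases Nat.eq_zero_or_pos N with rfl | hN
  · simp [avg, expStat]
  -- The statistic at `0` is the constant `N`, so the second moment gives `N` times the mean;
  -- dividing requires `N > 0`.
  have h := integral_expStat_mul_expStat (N := N) k 0
  simp only [expStat_zero, mul_zero, add_zero, gaussExp_zero_hermitePoly_mul, Fin.val_inj,
    if_true, div_self (hermiteNormSq_ne_zero _), mul_one, Finset.sum_sub_distrib] at h
  rw [integral_mul_const] at h
  have hδ : ∀ i : Fin N, ∑ j : Fin N,
      gaussExp (Complex.I * k) (hermitePoly i * hermitePoly j) / hermiteNormSq i *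
        ((if j = i then hermiteNormSq j else 0) / hermiteNormSq j) =
      gaussExp (Complex.I * k) (hermitePoly i * hermitePoly i) / hermiteNormSq i := by
    intro i
    rw [Finset.sum_eq_single i]
    · rw [if_pos rfl, div_self (hermiteNormSq_ne_zero _), mul_one]
    · intro j _ hj
      rw [if_neg hj, zero_div, mul_zero]
    · simp
  simp only [hδ, Finset.sum_const, Finset.card_univ, Fintype.card_fin, nsmul_eq_mul] at h
  rw [← Finset.mul_sum, add_sub_cancel, mul_comm] at h
  have hN' : (N : ℂ) ≠ 0 := by exact_mod_cast hN.ne'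
  exact mul_left_cancel₀ hN' h

theorem cov_eq_sub {A B : (Fin N × Fin N → ℝ) → ℂ} (hA : MemLp A 2 (measure N))
    (hB : MemLp B 2 (measure N)) :
    cov N A B = (∫ x, A x * B x ∂(measure N)) - avg N A * avg N B := by
  have iA := hA.integrable one_le_two
  have iB := hB.integrable one_le_two
  have iAB : Integrable (fun x => A x * B x) (measure N) := hA.integrable_mul hB
  have h : ∀ x, (A x - avg N A) * (B x - avg N B) =
      A x * B x - A x * avg N B - (avg N A * B x - avg N A * avg N B) := fun x => by ring
  rw [cov]
  conv_lhs => rw [avg]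
  simp only [h]
  have i₁ : Integrable (fun x => A x * avg N B) (measure N) := iA.mul_const _
  have i₂ : Integrable (fun x => avg N A * B x) (measure N) := iB.const_mul _
  have i₃ : Integrable (fun x => A x * B x - A x * avg N B) (measure N) := iAB.sub i₁
  have i₄ : Integrable (fun x => avg N A * B x - avg N A * avg N B) (measure N) :=
    i₂.sub (integrable_const _)
  rw [integral_sub i₃ i₄, integral_sub iAB i₁, integral_sub i₂ (integrable_const _),
    integral_mul_const, integral_const_mul]
  simp only [integral_const, probReal_univ, one_smul]
  simp only [avg]
  ring

/-- The covariance of the exponential statistics as a finite sum of Gaussian integrals. -/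
def covSum (N : ℕ) (k₁ k₂ : ℂ) : ℂ :=
  ∑ i ∈ Finset.range N, gaussExp (Complex.I * (k₁ - k₂)) (hermitePoly i * hermitePoly i) /
      hermiteNormSq i -
    ∑ i ∈ Finset.range N, ∑ j ∈ Finset.range N,
      gaussExp (Complex.I * k₁) (hermitePoly i * hermitePoly j) *
        gaussExp (-(Complex.I * k₂)) (hermitePoly i * hermitePoly j) /
          (hermiteNormSq i * hermiteNormSq j)

theorem cov_expStat (k₁ k₂ : ℂ) :
    cov N (expStat N k₁) (expStat N (-k₂)) = covSum N k₁ k₂ := by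
  rw [cov_eq_sub (memLp_expStat _) (memLp_expStat _), integral_expStat_mul_expStat, avg_expStat,
    avg_expStat, covSum, Finset.sum_range, Finset.sum_mul_sum]
  simp only [Finset.sum_range, Finset.sum_sub_distrib]
  rw [add_sub_assoc, sub_sub_cancel_left, ← sub_eq_add_neg]
  congr 1
  · refine Finset.sum_congr rfl fun i _ => ?_
    rw [show Complex.I * k₁ + Complex.I * -k₂ = Complex.I * (k₁ - k₂) by ring]
  · refine Finset.sum_congr rfl fun i _ => Finset.sum_congr rfl fun j _ => ?_
    rw [mul_neg, mul_comm (hermitePoly j) (hermitePoly i), div_mul_div_comm]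

theorem covSum_zero_right (k : ℂ) : covSum N k 0 = 0 := by
  simp only [covSum, mul_zero, neg_zero, sub_zero, gaussExp_zero_hermitePoly_mul]
  rw [sub_eq_zero]
  refine Finset.sum_congr rfl fun i hi => ?_
  rw [Finset.sum_eq_single i]
  · rw [if_pos rfl, mul_div_mul_right _ _ (hermiteNormSq_ne_zero _)]
  · intro j _ hj
    rw [if_neg hj.symm, mul_zero, zero_div]
  · exact fun h => absurd hi h

section Telescoping

/-- The Christoffel–Darboux type numerator
`(u_n v_{n-1} - u_{n-1} v_n) / c_{n-1}` for the Hermite norms `c`. -/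
def wronskian (u v : ℕ → ℂ) : ℕ → ℂ
  | 0 => 0
  | n + 1 => (u (n + 1) * v n - u n * v (n + 1)) / hermiteNormSq n

theorem hermiteNormSq_mul_wronskian (u v : ℕ → ℂ) (n : ℕ) :
    hermiteNormSq n * wronskian u v n = (n : ℂ) / 2 * (u n * v (n - 1) - u (n - 1) * v n) := by
  cases n with
  | zero => simp [wronskian]
  | succ n =>
    rw [wronskian, hermiteNormSq_succ, Nat.add_sub_cancel, mul_assoc,
      mul_div_cancel₀ _ (hermiteNormSq_ne_zero n)]
    push_cast
    rfl

/-- The recursions of `u` and `v` have opposite signs, so the derivative of the `i`-th summand is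
`I` times the increment of `wronskian` from `i` to `i + 1`. -/
theorem hasDerivAt_sum_telescope (u v : ℕ → ℂ → ℂ) (t : ℂ)
    (hu : ∀ i, HasDerivAt (u i) (Complex.I * (u (i + 1) t + (i : ℂ) / 2 * u (i - 1) t)) t)
    (hv : ∀ i, HasDerivAt (v i) (-Complex.I * (v (i + 1) t + (i : ℂ) / 2 * v (i - 1) t)) t)
    (n : ℕ) :
    HasDerivAt (fun t => ∑ i ∈ Finset.range n, u i t * v i t / hermiteNormSq i)
      (Complex.I * wronskian (fun i => u i t) (fun i => v i t) n) t := by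
  induction n with
  | zero => simpa [wronskian] using hasDerivAt_const t (0 : ℂ)
  | succ n ih =>
    simp only [Finset.sum_range_succ]
    refine (ih.add (((hu n).mul (hv n)).div_const (hermiteNormSq n))).congr_deriv ?_
    have h := hermiteNormSq_mul_wronskian (fun i => u i t) (fun i => v i t) n
    have hc := hermiteNormSq_ne_zero n
    have h' : wronskian (fun i => u i t) (fun i => v i t) n =
        (n : ℂ) / 2 * (u n t * v (n - 1) t - u (n - 1) t * v n t) / hermiteNormSq n := by
      rw [eq_div_iff hc, mul_comm, h]
    rw [h', wronskian]
    field_simp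
    ring

end Telescoping

theorem gaussExp_X_mul_hermitePoly_mul (a : ℂ) (n i : ℕ) :
    gaussExp a (X * (hermitePoly n * hermitePoly i)) =
      gaussExp a (hermitePoly n * hermitePoly (i + 1)) +
        (i : ℂ) / 2 * gaussExp a (hermitePoly n * hermitePoly (i - 1)) := by
  rw [mul_left_comm, X_mul_hermitePoly, mul_add, map_add, mul_left_comm, ← smul_eq_C_mul, map_smul,
    smul_eq_mul]

/-- Moving the raising operator off `h_{n+1}` expresses this combination by the diagonal integral;
it produces the factor `(t₁ + t₂)/2` of `H`. -/
theorem gaussExp_hermitePoly_mul_succ_sub (a : ℂ) (n : ℕ) :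
    gaussExp a (hermitePoly n * hermitePoly (n + 1)) -
      (n : ℂ) / 2 * gaussExp a (hermitePoly n * hermitePoly (n - 1)) =
        a / 2 * gaussExp a (hermitePoly n * hermitePoly n) := by
  rw [mul_comm, gaussExp_hermitePoly_succ_mul, derivative_hermitePoly, mul_left_comm,
    ← smul_eq_C_mul, map_smul, smul_eq_mul]
  ring

/-- The double sum gains a row and a column, equal by symmetry; the corner is placed in the second
sum. -/
theorem covSum_succ (N : ℕ) (k₁ k₂ : ℂ) :
    covSum (N + 1) k₁ k₂ = covSum N k₁ k₂ +
      (gaussExp (Complex.I * (k₁ - k₂)) (hermitePoly N * hermitePoly N) -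
        (∑ i ∈ Finset.range N, gaussExp (Complex.I * k₁) (hermitePoly N * hermitePoly i) *
          gaussExp (-(Complex.I * k₂)) (hermitePoly N * hermitePoly i) / hermiteNormSq i) -
        ∑ i ∈ Finset.range (N + 1), gaussExp (Complex.I * k₁) (hermitePoly N * hermitePoly i) *
          gaussExp (-(Complex.I * k₂)) (hermitePoly N * hermitePoly i) / hermiteNormSq i) /
        hermiteNormSq N := by
  have hc := hermiteNormSq_ne_zero N
  have h1 : ∑ i ∈ Finset.range N, gaussExp (Complex.I * k₁) (hermitePoly i * hermitePoly N) *
        gaussExp (-(Complex.I * k₂)) (hermitePoly i * hermitePoly N) /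
          (hermiteNormSq i * hermiteNormSq N) =
      (∑ i ∈ Finset.range N, gaussExp (Complex.I * k₁) (hermitePoly N * hermitePoly i) *
          gaussExp (-(Complex.I * k₂)) (hermitePoly N * hermitePoly i) / hermiteNormSq i) /
        hermiteNormSq N := by
    rw [Finset.sum_div]
    refine Finset.sum_congr rfl fun i _ => ?_
    rw [mul_comm (hermitePoly i), div_div]
  have h2 : ∑ i ∈ Finset.range N, gaussExp (Complex.I * k₁) (hermitePoly N * hermitePoly i) *
        gaussExp (-(Complex.I * k₂)) (hermitePoly N * hermitePoly i) /
          (hermiteNormSq N * hermiteNormSq i) =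
      (∑ i ∈ Finset.range N, gaussExp (Complex.I * k₁) (hermitePoly N * hermitePoly i) *
          gaussExp (-(Complex.I * k₂)) (hermitePoly N * hermitePoly i) / hermiteNormSq i) /
        hermiteNormSq N := by
    rw [Finset.sum_div]
    refine Finset.sum_congr rfl fun i _ => ?_
    rw [mul_comm (hermiteNormSq N), div_div]
  simp only [covSum, Finset.sum_range_succ, Finset.sum_add_distrib, h1, h2]
  field_simp
  ring

end Covariance

end GUE

/-! ### Norms of the Laguerre polynomials. -/

namespace LUE

/-- The sum is, up to sign, an `n`-th finite difference, which sees only the coefficient of degree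
`n`. -/
theorem sum_neg_one_pow_mul_choose_mul_eval (n : ℕ) (r : ℝ[X]) (hr : r.natDegree ≤ n) :
    ∑ m ∈ Finset.range (n + 1), (-1 : ℝ) ^ m * (n.choose m : ℝ) * r.eval (m : ℝ) =
      (-1) ^ n * (n ! : ℝ) * r.coeff n := by
  have h1 : (fwdDiff (1 : ℝ))^[n] (fun x : ℝ => r.eval x) = fun _ => r.coeff n * (n ! : ℝ) := by
    have h : (fun x : ℝ => r.eval x) = (fun x : ℝ => ∑ k ∈ Finset.range n, r.coeff k * x ^ k) +
        r.coeff n • fun x : ℝ => x ^ n := by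
      funext x
      rw [eval_eq_sum_range' (Nat.lt_succ_of_le hr), Finset.sum_range_succ]
      rfl
    rw [h, fwdDiff_iter_add, fwdDiff_iter_sum_mul_pow_eq_zero, fwdDiff_iter_const_smul,
      fwdDiff_iter_eq_factorial]
    funext x
    simp
  have h2 := fwdDiff_iter_eq_sum_shift (1 : ℝ) (fun x : ℝ => r.eval x) n 0
  rw [h1] at h2
  have h3 : ∀ m ∈ Finset.range (n + 1), (-1 : ℝ) ^ m * (n.choose m : ℝ) * r.eval (m : ℝ) =
      (-1) ^ n * (((-1 : ℤ) ^ (n - m) * (n.choose m : ℤ)) • r.eval (0 + m • (1 : ℝ))) := by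
    intro m hm
    have hm : m ≤ n := Nat.lt_succ_iff.1 (Finset.mem_range.1 hm)
    have : (-1 : ℝ) ^ n * (-1) ^ (n - m) = (-1) ^ m := by
      rw [← pow_add, show n + (n - m) = m + 2 * (n - m) by omega, pow_add, pow_mul]
      simp
    rw [zsmul_eq_mul, ← this]
    push_cast
    simp only [zero_add, nsmul_eq_mul, mul_one]
    ring
  rw [Finset.sum_congr rfl h3, ← Finset.mul_sum, ← h2]
  ring

theorem integrableOn_exp_neg_mul_pow (k : ℕ) :
    IntegrableOn (fun x : ℝ => Real.exp (-x) * x ^ k) (Set.Ioi 0) := by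
  have h := Real.GammaIntegral_convergent (s := k + 1) (by positivity)
  simpa using h

theorem integral_exp_neg_mul_pow (k : ℕ) :
    ∫ x in Set.Ioi (0 : ℝ), Real.exp (-x) * x ^ k = (k ! : ℝ) := by
  have h := Real.Gamma_eq_integral (s := k + 1) (by positivity)
  rw [Real.Gamma_nat_eq_factorial] at h
  simpa using h.symm

theorem integral_exp_neg_mul_laguerre_sq (n : ℕ) :
    ∫ x in Set.Ioi (0 : ℝ), Real.exp (-x) * ((laguerre n).eval x) ^ 2 = 1 := by
  set l : ℕ → ℝ := fun m => (-1 : ℝ) ^ m * (n.choose m : ℝ) / (m ! : ℝ) with hl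
  have h1 : ∀ x : ℝ, Real.exp (-x) * ((laguerre n).eval x) ^ 2 =
      ∑ j ∈ Finset.range (n + 1), ∑ m ∈ Finset.range (n + 1),
        l j * l m * (Real.exp (-x) * x ^ (m + j)) := by
    intro x
    rw [laguerre, eval_finsetSum, sq, Finset.sum_mul_sum, Finset.mul_sum]
    refine Finset.sum_congr rfl fun j _ => ?_
    rw [Finset.mul_sum]
    refine Finset.sum_congr rfl fun m _ => ?_
    simp only [eval_mul, eval_C, eval_pow, eval_X, hl]
    ring
  have hintegrable : ∀ j m : ℕ, Integrable (fun x : ℝ => l j * l m * (Real.exp (-x) * x ^ (m + j)))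
      (volume.restrict (Set.Ioi 0)) := fun j m => (integrableOn_exp_neg_mul_pow (m + j)).const_mul _
  simp only [h1]
  rw [integral_finsetSum _ fun j _ => integrable_finsetSum _ fun m _ => hintegrable j m]
  have h2 : ∀ j ∈ Finset.range (n + 1), ∫ x in Set.Ioi (0 : ℝ), ∑ m ∈ Finset.range (n + 1),
      l j * l m * (Real.exp (-x) * x ^ (m + j)) =
      if j = n then 1 else 0 := by
    intro j hj
    have hj : j ≤ n := Nat.lt_succ_iff.1 (Finset.mem_range.1 hj)
    rw [integral_finsetSum _ fun m _ => hintegrable j m]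
    simp only [integral_const_mul, integral_exp_neg_mul_pow]
    -- At `m` this takes the value `(m + 1)⋯(m + j) = (m + j)! / m!`. It is monic of degree `j`, so
    -- the alternating sum vanishes unless `j = n`.
    set r : ℝ[X] := (ascPochhammer ℝ j).comp (X + C 1) with hr
    have hdeg : r.natDegree = j := by
      rw [hr, natDegree_comp, ascPochhammer_natDegree, natDegree_X_add_C, mul_one]
    have hmon : r.Monic := (monic_ascPochhammer ℝ j).comp_X_add_C 1
    have h3 : ∀ m ∈ Finset.range (n + 1), l j * l m * ((m + j)! : ℝ) =
        l j * ((-1 : ℝ) ^ m * (n.choose m : ℝ) * r.eval (m : ℝ)) := by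
      intro m _
      have hm : (m ! : ℝ) ≠ 0 := by exact_mod_cast m.factorial_ne_zero
      have := factorial_mul_ascPochhammer ℝ m j
      simp only [hr, eval_comp, eval_add, eval_X, eval_C, hl]
      rw [← this]
      field_simp
    rw [Finset.sum_congr rfl h3, ← Finset.mul_sum,
      sum_neg_one_pow_mul_choose_mul_eval n r (hdeg.le.trans hj)]
    split_ifs with hjn
    · subst hjn
      have hc : r.coeff j = 1 := by rw [← hdeg]; exact hmon
      have hf : (j ! : ℝ) ≠ 0 := by exact_mod_cast j.factorial_ne_zero
      rw [hc]
      simp only [hl, Nat.choose_self]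
      field_simp
      rw [← pow_mul, mul_comm, pow_mul]
      simpa using neg_one_pow_eq_or ℝ j
    · rw [coeff_eq_zero_of_natDegree_lt (by omega)]
      simp
  rw [Finset.sum_congr rfl h2]
  simp

theorem normSq_eq (n : ℕ) : normSq n = (n ! : ℝ) ^ 2 := by
  rw [normSq]
  have h : ∀ x : ℝ, Real.exp (-x) * ((monicPoly n).eval x) ^ 2 =
      (n ! : ℝ) ^ 2 * (Real.exp (-x) * ((laguerre n).eval x) ^ 2) := by
    intro x
    have : ((-1 : ℝ) ^ n) ^ 2 = 1 := by rw [← pow_mul, mul_comm, pow_mul]; simp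
    rw [monicPoly, eval_mul, eval_C]
    linear_combination ((n ! : ℝ) ^ 2 * (Real.exp (-x) * ((laguerre n).eval x) ^ 2)) * this
  simp only [h, integral_const_mul, integral_exp_neg_mul_laguerre_sq, mul_one]

theorem psi_mul_psi_div_normSq (n : ℕ) (x y : ℂ) :
    psi n x * psi n y / (normSq n : ℂ) =
      (Complex.exp (-x / 2) * aeval x (laguerre n)) *
        (Complex.exp (-y / 2) * aeval y (laguerre n)) := by
  have hf : (n ! : ℂ) ≠ 0 := by exact_mod_cast n.factorial_ne_zero
  have : ((-1 : ℂ) ^ n) ^ 2 = 1 := by rw [← pow_mul, mul_comm, pow_mul]; simp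
  rw [normSq_eq]
  simp only [psi, monicPoly, map_mul, aeval_C, Complex.coe_algebraMap]
  push_cast
  rw [div_eq_iff (pow_ne_zero 2 hf)]
  linear_combination (Complex.exp (-x / 2) * aeval x (laguerre n) *
    (Complex.exp (-y / 2) * aeval y (laguerre n)) * (n ! : ℂ) ^ 2) * this

end LUE

/-! ### Differentiation along `(d + t, t)` and integration. -/

namespace GUE

/-- At `a = ±ik` the diagonal integral is `c_n exp(-k²/4) L_n(k²/2)`, a Laguerre function at `k²/2`.
-/
theorem gaussExp_hermitePoly_sq_mul_eq_psi (n : ℕ) (k₁ k₂ : ℂ) :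
    gaussExp (Complex.I * k₁) (hermitePoly n * hermitePoly n) *
        gaussExp (-(Complex.I * k₂)) (hermitePoly n * hermitePoly n) / hermiteNormSq n ^ 2 =
      LUE.psi n (k₁ ^ 2 / 2) * LUE.psi n (k₂ ^ 2 / 2) / (LUE.normSq n : ℂ) := by
  have hc := hermiteNormSq_ne_zero n
  have e : ∀ k : ℂ, (Complex.I * k) ^ 2 = -k ^ 2 := fun k => by
    rw [mul_pow, Complex.I_sq]; ring
  rw [LUE.psi_mul_psi_div_normSq, gaussExp_hermitePoly_sq, gaussExp_hermitePoly_sq, neg_sq, e, e,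
    neg_neg, neg_neg, show ∀ k : ℂ, -(k ^ 2 / 2) / 2 = -k ^ 2 / 4 from fun k => by ring,
    show ∀ k : ℂ, -(k ^ 2 / 2) / 2 = -k ^ 2 / 4 from fun k => by ring]
  field_simp

/-- With the difference `d` fixed, only the double sum varies. Its increment in `N` has derivative
`-I (W_N + W_{N+1}) / c_N`, where `W` is `wronskian`, and this is the `N`-th term of `H`. -/
theorem hasDerivAt_covSum (N : ℕ) (d t : ℂ) :
    HasDerivAt (fun t => covSum N (d + t) t) (LUE.H N (d + t) t) t := by
  induction N with
  | zero => simpa [covSum, LUE.H, LUE.kernel] using hasDerivAt_const t (0 : ℂ)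
  | succ N ih =>
    set u : ℕ → ℂ → ℂ := fun i t =>
      gaussExp (Complex.I * (d + t)) (hermitePoly N * hermitePoly i) with hu
    set v : ℕ → ℂ → ℂ := fun i t =>
      gaussExp (-(Complex.I * t)) (hermitePoly N * hermitePoly i) with hv
    have hu' : ∀ i, HasDerivAt (u i)
        (Complex.I * (u (i + 1) t + (i : ℂ) / 2 * u (i - 1) t)) t := by
      intro i
      have h1 : HasDerivAt (fun t : ℂ => Complex.I * (d + t)) Complex.I t := by
        simpa using ((hasDerivAt_id t).const_add d).const_mul Complex.I
      have h2 := (hasDerivAt_gaussExp (hermitePoly N * hermitePoly i)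
        (Complex.I * (d + t))).comp t h1
      rw [gaussExp_X_mul_hermitePoly_mul] at h2
      exact h2.congr_deriv (mul_comm _ _)
    have hv' : ∀ i, HasDerivAt (v i)
        (-Complex.I * (v (i + 1) t + (i : ℂ) / 2 * v (i - 1) t)) t := by
      intro i
      have h1 : HasDerivAt (fun t : ℂ => -(Complex.I * t)) (-Complex.I) t := by
        exact ((hasDerivAt_id t).const_mul Complex.I).neg.congr_deriv (by simp)
      have h2 := (hasDerivAt_gaussExp (hermitePoly N * hermitePoly i)
        (-(Complex.I * t))).comp t h1
      rw [gaussExp_X_mul_hermitePoly_mul] at h2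
      exact h2.congr_deriv (mul_comm _ _)
    have hS := hasDerivAt_sum_telescope u v t hu' hv'
    have hsucc : (fun t => covSum (N + 1) (d + t) t) = fun t => covSum N (d + t) t +
        (gaussExp (Complex.I * d) (hermitePoly N * hermitePoly N) -
          (∑ i ∈ Finset.range N, u i t * v i t / hermiteNormSq i) -
          ∑ i ∈ Finset.range (N + 1), u i t * v i t / hermiteNormSq i) / hermiteNormSq N := by
      funext t
      rw [covSum_succ, add_sub_cancel_right]
    rw [hsucc]
    refine (ih.add ((((hasDerivAt_const t _).sub (hS N)).sub (hS (N + 1))).div_const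
      (hermiteNormSq N))).congr_deriv ?_
    have hH : LUE.H (N + 1) (d + t) t = LUE.H N (d + t) t +
        (d + t + t) / 2 * (u N t * v N t / hermiteNormSq N ^ 2) := by
      rw [hu, hv, gaussExp_hermitePoly_sq_mul_eq_psi]
      simp only [LUE.H, LUE.kernel, Finset.sum_range_succ]
      ring
    have hc := hermiteNormSq_ne_zero N
    have hw := hermiteNormSq_mul_wronskian (fun i => u i t) (fun i => v i t) N
    have hw' : hermiteNormSq N * wronskian (fun i => u i t) (fun i => v i t) (N + 1) =
        u (N + 1) t * v N t - u N t * v (N + 1) t := by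
      rw [wronskian, mul_div_cancel₀ _ hc]
    have hk₁ := gaussExp_hermitePoly_mul_succ_sub (Complex.I * (d + t)) N
    have hk₂ := gaussExp_hermitePoly_mul_succ_sub (-(Complex.I * t)) N
    change u (N + 1) t - (N : ℂ) / 2 * u (N - 1) t = _ * u N t at hk₁
    change v (N + 1) t - (N : ℂ) / 2 * v (N - 1) t = _ * v N t at hk₂
    have hsum : hermiteNormSq N * (wronskian (fun i => u i t) (fun i => v i t) N +
        wronskian (fun i => u i t) (fun i => v i t) (N + 1)) =
        Complex.I / 2 * (d + t + t) * (u N t * v N t) := by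
      rw [mul_add, hw, hw']
      -- Neighbouring indices occur only as `u_{N+1} - (N/2) u_{N-1}` and its analogue for `v`; the
      -- tilts `I(d + t)` and `-It` then subtract to `I(d + 2t)`.
      linear_combination v N t * hk₁ - u N t * hk₂
    rw [hH]
    congr 1
    field_simp
    linear_combination (-2 * Complex.I) * hsum - (d + t + t) * (u N t * v N t) * Complex.I_sq

theorem continuous_H_uncurried (N : ℕ) : Continuous fun p : ℂ × ℂ => LUE.H N p.1 p.2 := by
  unfold LUE.H LUE.kernel LUE.psi
  simp only [aeval_def, eval₂_eq_sum_range]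
  fun_prop

theorem cov_expStat_eq_segment_integral (N : ℕ) (k₁ k₂ : ℂ) :
    cov N (expStat N k₁) (expStat N (-k₂)) =
      ∫ s in (0 : ℝ)..1, k₂ * LUE.H N (k₁ - k₂ + (s : ℂ) * k₂) ((s : ℂ) * k₂) := by
  have hcont : Continuous fun s : ℝ =>
      k₂ * LUE.H N (k₁ - k₂ + (s : ℂ) * k₂) ((s : ℂ) * k₂) := by
    refine continuous_const.mul ((continuous_H_uncurried N).comp (?_ : Continuous fun s : ℝ =>
      ((k₁ - k₂ + (s : ℂ) * k₂, (s : ℂ) * k₂) : ℂ × ℂ)))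
    fun_prop
  rw [intervalIntegral.integral_eq_sub_of_hasDerivAt
    (f := fun s : ℝ => covSum N (k₁ - k₂ + (s : ℂ) * k₂) ((s : ℂ) * k₂)) ?_
    (hcont.intervalIntegrable _ _)]
  · simp only [Complex.ofReal_one, one_mul, sub_add_cancel, Complex.ofReal_zero, zero_mul,
      covSum_zero_right, sub_zero]
    exact cov_expStat k₁ k₂
  · intro s _
    have h1 : HasDerivAt (fun s : ℝ => (s : ℂ) * k₂) k₂ s := by
      simpa using (Complex.ofRealCLM.hasDerivAt (x := s)).mul_const k₂
    have h2 := (hasDerivAt_covSum N (k₁ - k₂) ((s : ℂ) * k₂)).comp s h1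
    rw [mul_comm] at h2
    exact h2

theorem cov_expStat_eq_real_integral (N : ℕ) (k₁ k₂ : ℝ) :
    cov N (expStat N (k₁ : ℂ)) (expStat N (-(k₂ : ℂ))) =
      ∫ s in (0 : ℝ)..k₂, LUE.H N ((k₁ : ℂ) - (k₂ : ℂ) + (s : ℂ)) (s : ℂ) := by
  have hcont : Continuous fun s : ℝ => LUE.H N ((k₁ : ℂ) - (k₂ : ℂ) + (s : ℂ)) (s : ℂ) := by
    refine (continuous_H_uncurried N).comp (?_ : Continuous fun s : ℝ =>
      (((k₁ : ℂ) - (k₂ : ℂ) + (s : ℂ), (s : ℂ)) : ℂ × ℂ))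
    fun_prop
  rw [intervalIntegral.integral_eq_sub_of_hasDerivAt
    (f := fun s : ℝ => covSum N ((k₁ : ℂ) - (k₂ : ℂ) + (s : ℂ)) (s : ℂ))
    (fun s _ => (hasDerivAt_covSum N ((k₁ : ℂ) - k₂) (s : ℂ)).comp_ofReal)
    (hcont.intervalIntegrable _ _)]
  simp only [sub_add_cancel, Complex.ofReal_zero, covSum_zero_right, sub_zero]
  exact cov_expStat _ _

theorem conj_expStat (N : ℕ) (k : ℝ) (x : Fin N × Fin N → ℝ) :
    (starRingEnd ℂ) (expStat N (k : ℂ) x) = expStat N (-(k : ℂ)) x := by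
  simp [expStat, ← Complex.exp_conj]

theorem structureFunction_eq_cov (N : ℕ) (k : ℝ) :
    (structureFunction N k : ℂ) = cov N (expStat N (k : ℂ)) (expStat N (-(k : ℂ))) := by
  rw [cov_eq_sub (memLp_expStat _) (memLp_expStat _), structureFunction]
  have h1 : avg N (expStat N (-(k : ℂ))) = (starRingEnd ℂ) (avg N (expStat N (k : ℂ))) := by
    simp only [avg, ← integral_conj, conj_expStat]
  rw [h1, Complex.mul_conj, Complex.normSq_eq_norm_sq]
  push_cast
  congr 1
  rw [← integral_complex_ofReal]
  refine integral_congr_ae (Filter.Eventually.of_forall fun x => ?_)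
  simp only [← conj_expStat, Complex.mul_conj, Complex.normSq_eq_norm_sq]

end GUE

end

/-- For complex `k₁, k₂` the integral from `0` to `k₂` is along the straight segment
(second conjunct); for real `k₁, k₂` it is the ordinary one (third conjunct). -/
theorem proposition11 (N : ℕ) :
    (∀ k : ℂ, MemLp (GUE.expStat N k) 2 (GUE.measure N)) ∧
    (∀ k₁ k₂ : ℂ,
      GUE.cov N (GUE.expStat N k₁) (GUE.expStat N (-k₂)) =
        ∫ s in (0 : ℝ)..1, k₂ * LUE.H N (k₁ - k₂ + (s : ℂ) * k₂) ((s : ℂ) * k₂)) ∧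
    (∀ k₁ k₂ : ℝ,
      GUE.cov N (GUE.expStat N (k₁ : ℂ)) (GUE.expStat N (-(k₂ : ℂ))) =
        ∫ s in (0 : ℝ)..k₂, LUE.H N ((k₁ : ℂ) - (k₂ : ℂ) + (s : ℂ)) (s : ℂ)) ∧
    (∀ k : ℝ,
      (GUE.structureFunction N k : ℂ) =
        ∫ t in (0 : ℝ)..k, (t : ℂ) * LUE.kernel N ((t : ℂ) ^ 2 / 2) ((t : ℂ) ^ 2 / 2)) := by
  refine ⟨GUE.memLp_expStat, GUE.cov_expStat_eq_segment_integral N,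
    GUE.cov_expStat_eq_real_integral N, fun k => ?_⟩
  rw [GUE.structureFunction_eq_cov, GUE.cov_expStat_eq_real_integral]
  simp only [LUE.H, sub_self, zero_add, add_self_div_two]
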